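/- Let $d\ge 1$, let $\Omega\subset\mathbb R^d$ be open and bounded, $T>0$, $p\in(1,\infty)$ and $p'=\frac{p}{p-1}$. Let $\zeta,\beta:\mathbb R\to\mathbb R$ be non-decreasing and Lipschitz continuous with constants $L_\zeta,L_\beta>0$ respectively, with $\zeta(0)=\beta(0)=0$, and assume that for some $M_0,M_1>0$ one has $|\zeta(s)|\ge M_0|s|-M_1$ for all $s\in\mathbb R$. Let $R_\beta$ be the range of $\beta$, and for $s\in R_\beta$ let $\beta_r(s)$ be the point $t$ closest to $0$ such that $\beta(t)=s$. Set $B(z)=\int_0^z\zeta(\beta_r(s))\,ds$ for $z\in R_\beta$, and extend $B$ to $\overline{R_\beta}$, with values in $[0,\infty]$, by its limits at the endpoints of $R_\beta$. Here $W^{1,p}_0(\Omega)$ is the closure of $C_c^\infty(\Omega)$ in $W^{1,p}(\Omega)$ and $W^{-1,p'}(\Omega)$ is its dual. Let $v:\Omega\times(0,T)\to\mathbb R$ be measurable and such that 1. $\zeta(v)\in L^p(0,T;W^{1,p}_0(\Omega))$; 2. $B(\beta(v))\in L^\infty(0,T;L^1(\Omega))$; 3. $\beta(v)\in C([0,T];L^2(\Omega)\text{-w})$,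 i.e. there is a function $\beta(v)(\cdot):[0,T]\to L^2(\Omega)$, continuous for the weak topology of $L^2(\Omega)$, such that for a.e. $t\in(0,T)$, $\beta(v)(x,t)=\beta(v(x,t))$ for a.e. $x\in\Omega$; 4. the time derivative $\partial_t\beta(v)$, in the sense of distributions on $\Omega\times(0,T)$, belongs to $L^{p'}(0,T;W^{-1,p'}(\Omega))$. Then, $\beta(v)(\cdot,t)$ denoting for every $t\in[0,T]$ the value at $t$ of the weakly continuous function in 3, the integral $\int_\Omega B(\beta(v)(x,t))\,dx$ is finite for every $t\in[0,T]$, the function $$t\in[0,T]\mapsto\int_\Omega B(\beta(v)(x,t))\,dx\in[0,\infty)$$ is continuous, and, for all $t_1,t_2\in[0,T]$, $$\int_{t_1}^{t_2}\langle\partial_t\beta(v)(t),\zeta(v(\cdot,t))\rangle_{W^{-1,p'},W^{1,p}_0}\,dt=\int_\Omega B(\beta(v)(x,t_2))\,dx-\int_\Omega B(\beta(v)(x,t_1))\,dx,$$ where the integrand on the left is integrable on $(0,T)$. -/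

import Mathlib

open MeasureTheory Set Filter Topology TopologicalSpace
open scoped ENNReal NNReal Distributions

noncomputable section

namespace DegenerateParabolic

/-- The pseudo-inverse `β_r` of `β`: for `s` in the range of `β`, the point `t` closest to `0`
with `β t = s`. -/
def pseudoInv (β : ℝ → ℝ) (s : ℝ) : ℝ :=
  if 0 < s then sInf {t | β t = s} else if s < 0 then sSup {t | β t = s} else 0

/-- The integral `∫_0^z ζ(β_r(s)) ds`, meant for `z` in the range of `β`. -/
def primitiveB (β ζ : ℝ → ℝ) (z : ℝ) : ℝ :=
  ∫ s in (0 : ℝ)..z, ζ (pseudoInv β s)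

open Classical in
/-- The function `B` on the closure of the range `R_β` of `β`, with values in `[0, ∞]`:
it is `∫_0^z ζ(β_r(s)) ds` on `R_β`, and at an endpoint of `R_β` outside `R_β` it is the limit
(possibly `∞`) of these values along `R_β`. Values outside the closure of `R_β` mean nothing. -/
def functionB (β ζ : ℝ → ℝ) (z : ℝ) : ℝ≥0∞ :=
  if z ∈ range β then ENNReal.ofReal (primitiveB β ζ z)
  else limUnder (𝓝[range β] z) (fun y => ENNReal.ofReal (primitiveB β ζ y))

variable {d : ℕ}

theorem gradient_testFunction_memLp (Ω : Opens (EuclideanSpace ℝ (Fin d))) (p : ℝ≥0∞)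
    (γ : 𝓓(Ω, ℝ)) : MemLp (gradient γ) p (volume.restrict (Ω : Set (EuclideanSpace ℝ (Fin d)))) := by
  have hc : Continuous (gradient γ) := by
    have h1 : Continuous (fderiv ℝ γ) := γ.contDiff.continuous_fderiv (by simp)
    exact (InnerProductSpace.toDual ℝ (EuclideanSpace ℝ (Fin d))).symm.continuous.comp h1
  have hs : HasCompactSupport (gradient γ) := by
    have h2 : HasCompactSupport (fderiv ℝ γ) := γ.hasCompactSupport.fderiv ℝ
    exact h2.comp_left (g := (InnerProductSpace.toDual ℝ (EuclideanSpace ℝ (Fin d))).symm)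
      (by simp)
  exact hc.memLp_of_hasCompactSupport hs

theorem testFunction_memLp (Ω : Opens (EuclideanSpace ℝ (Fin d))) (p : ℝ≥0∞)
    (γ : 𝓓(Ω, ℝ)) : MemLp γ p (volume.restrict (Ω : Set (EuclideanSpace ℝ (Fin d)))) :=
  γ.continuous.memLp_of_hasCompactSupport γ.hasCompactSupport

/-- The space `L^p(Ω) × L^p(Ω)^d`, in which a Sobolev function `u` is represented by the pair
`(u, ∇u)`. The norm of a pair is the larger of the two `L^p` norms, which on such pairs is
equivalent to the usual `W^{1,p}` norm. -/
abbrev SobolevPair (Ω : Opens (EuclideanSpace ℝ (Fin d))) (p : ℝ≥0∞) : Type :=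
  Lp ℝ p (volume.restrict (Ω : Set (EuclideanSpace ℝ (Fin d)))) ×
    Lp (EuclideanSpace ℝ (Fin d)) p (volume.restrict (Ω : Set (EuclideanSpace ℝ (Fin d))))

/-- The pair `(γ, ∇γ)` of a test function `γ ∈ C_c^∞(Ω)`. -/
def testPair (Ω : Opens (EuclideanSpace ℝ (Fin d))) (p : ℝ≥0∞) :
    𝓓(Ω, ℝ) →ₗ[ℝ] SobolevPair Ω p where
  toFun γ := ((testFunction_memLp Ω p γ).toLp, (gradient_testFunction_memLp Ω p γ).toLp)
  map_add' γ η := by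
    have h : gradient (γ + η : 𝓓(Ω, ℝ)) = gradient γ + gradient η := by
      funext x
      have h1 : fderiv ℝ (⇑γ + ⇑η) x
          = fderiv ℝ γ x + fderiv ℝ η x :=
        fderiv_add (γ.contDiff.differentiable (by simp) x) (η.contDiff.differentiable (by simp) x)
      simp [gradient, h1]
    ext1
    · exact MemLp.toLp_add (testFunction_memLp Ω p γ) (testFunction_memLp Ω p η)
    · simp only [h]
      exact MemLp.toLp_add (gradient_testFunction_memLp Ω p γ) (gradient_testFunction_memLp Ω p η)
  map_smul' c γ := by
    have h : gradient (c • γ : 𝓓(Ω, ℝ)) = c • gradient γ := by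
      funext x
      have h1 : fderiv ℝ (c • ⇑γ) x = c • fderiv ℝ γ x :=
        fderiv_const_smul (γ.contDiff.differentiable (by simp) x) c
      simp [gradient, h1]
    ext1
    · exact MemLp.toLp_const_smul c (testFunction_memLp Ω p γ)
    · simp only [h]
      exact MemLp.toLp_const_smul c (gradient_testFunction_memLp Ω p γ)

/-- The space `W^{1,p}_0(Ω)`, the closure of `C_c^∞(Ω)` in the norm of `W^{1,p}(Ω)`. An element
is represented by its pair `(u, ∇u)`. -/
def W0 (Ω : Opens (EuclideanSpace ℝ (Fin d))) (p : ℝ≥0∞) [Fact (1 ≤ p)] :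
    Submodule ℝ (SobolevPair Ω p) :=
  (LinearMap.range (testPair Ω p)).topologicalClosure

/-- A test function as an element of `W^{1,p}_0(Ω)`. -/
def testW0 (Ω : Opens (EuclideanSpace ℝ (Fin d))) (p : ℝ≥0∞) [Fact (1 ≤ p)] (γ : 𝓓(Ω, ℝ)) :
    W0 Ω p :=
  ⟨testPair Ω p γ, Submodule.le_topologicalClosure _ ⟨γ, rfl⟩⟩

/-- The open time interval `(0,T)`. -/
def timeInterval (T : ℝ) : Opens ℝ := ⟨Ioo 0 T, isOpen_Ioo⟩

/-- `D`, with values in `W^{-1,p'}(Ω) = (W^{1,p}_0(Ω))'`, is the time derivative of `u` on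
`Ω × (0,T)` in the sense of distributions; it is tested against the products `φ(t) γ(x)` with
`φ ∈ C_c^∞(0,T)` and `γ ∈ C_c^∞(Ω)`. -/
def IsTimeDeriv (Ω : Opens (EuclideanSpace ℝ (Fin d))) (T : ℝ) (p : ℝ≥0∞) [Fact (1 ≤ p)]
    (u : EuclideanSpace ℝ (Fin d) × ℝ → ℝ) (D : ℝ → StrongDual ℝ (W0 Ω p)) : Prop :=
  ∀ (φ : 𝓓(timeInterval T, ℝ)) (γ : 𝓓(Ω, ℝ)),
    ∫ t in Ioo 0 T, φ t * D t (testW0 Ω p γ) =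
      -∫ t in Ioo 0 T, ∫ x in (Ω : Set (EuclideanSpace ℝ (Fin d))), u (x, t) * (deriv φ t * γ x)

end DegenerateParabolic

end

noncomputable section

namespace DegenerateParabolic

/-! ### The convex function `B` as a supremum of affine functions -/

section Envelope

variable {β ζ : ℝ → ℝ}

/-! The integrand `ζ ∘ β_r` of `B` is non-decreasing, so `B` is convex and `ζ a` is a subgradient of
`B` at `β a`. Formally `∂_t B(β(v)) = ζ(v) ∂_t β(v)`, but `β(v)` is only weakly continuous in time,
so the chain rule is derived from convexity alone.

Let `E t` be the integral of `B` over the weakly continuous representative `Z t`. With `B` replaced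
by the supremum `envelopeB` of its affine minorants, the energy is convex on `L²` and lower
semicontinuous by Fatou, hence weakly lower semicontinuous. So the almost-everywhere bound on `E`
holds at every time, and `E` is lower semicontinuous. Coercivity of `ζ` makes the envelope infinite
off the closure of the range of `β`, so finite energy forces `Z t` to take values where `functionB`
is meaningful.

The subgradient inequality, integrated over `Ω`, should give `E t - E s ≤ ∫_s^t ⟨D r, w t⟩ dr` for
almost every `t` and every `s`. Here `(Z t - Z s) ζ(v(t))` need not be integrable; a one-sided
Brezis–Browder argument (`integral_le_of_le_mul`) replaces it, using smooth truncations in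
`W^{1,p}_0`.

Take `s = t + h`, integrate over `t ∈ (t₁, t₂)` and divide by `h`. The pairings converge to `∫ ⟨D,
w⟩` by continuity of translations in `L^{p'}`, and the energies telescope to the averages of `E`
just after `t₂` and `t₁`. Lower semicontinuity controls the average at `t₁`; at `t₂` the subgradient
inequality and Hölder do (`eventually_intervalIntegral_le`). This yields `∫ ⟨D, w⟩ ≤ E t₂ - E t₁`
(`integral_pairing_le_sub`), and time reversal yields the converse. Continuity of the energy then
follows, as it is a constant plus the primitive of an integrable function. -/

theorem apply_pseudoInv (hβ : Monotone β) (hc : Continuous β) (h0 : β 0 = 0) {s : ℝ}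
    (hs : s ∈ range β) : β (pseudoInv β s) = s := by
  have hcl : IsClosed {t | β t = s} := isClosed_eq hc continuous_const
  have hne : {t | β t = s}.Nonempty := hs
  unfold pseudoInv
  split_ifs with h1 h2
  · refine hcl.csInf_mem hne ⟨0, fun t ht => ?_⟩
    by_contra! h
    have := hβ h.le
    have ht' : β t = s := ht
    linarith
  · refine hcl.csSup_mem hne ⟨0, fun t ht => ?_⟩
    by_contra! h
    have := hβ h.le
    have ht' : β t = s := ht
    linarith
  · rw [h0]
    linarith

/-- Where `β` is flat, `β_r (β a)` may differ from `a`; a strict inequality between values of `β`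
still orders the arguments. This suffices under an integral, where endpoints do not count. -/
theorem zeta_le_of_lt (hβ : Monotone β) (hc : Continuous β) (h0 : β 0 = 0) (hζ : Monotone ζ)
    {s a : ℝ} (hs : s ∈ range β) (h : β a < s) : ζ a ≤ ζ (pseudoInv β s) := by
  refine hζ (le_of_lt ?_)
  by_contra! h'
  have := hβ h'
  rw [apply_pseudoInv hβ hc h0 hs] at this
  linarith

theorem le_zeta_of_lt (hβ : Monotone β) (hc : Continuous β) (h0 : β 0 = 0) (hζ : Monotone ζ)
    {s a : ℝ} (hs : s ∈ range β) (h : s < β a) : ζ (pseudoInv β s) ≤ ζ a := by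
  refine hζ (le_of_lt ?_)
  by_contra! h'
  have := hβ h'
  rw [apply_pseudoInv hβ hc h0 hs] at this
  linarith

theorem uIcc_subset_range (hc : Continuous β) (a b : ℝ) : uIcc (β a) (β b) ⊆ range β :=
  (isPreconnected_range hc).ordConnected.uIcc_subset ⟨a, rfl⟩ ⟨b, rfl⟩

theorem intervalIntegrable_zeta_pseudoInv (hβ : Monotone β) (hc : Continuous β) (h0 : β 0 = 0)
    (hζ : Monotone ζ) (a b : ℝ) :
    IntervalIntegrable (fun s => ζ (pseudoInv β s)) volume (β a) (β b) := by
  refine MonotoneOn.intervalIntegrable fun x hx y hy hxy => ?_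
  rcases hxy.eq_or_lt with rfl | hlt
  · exact le_rfl
  · have hx' := uIcc_subset_range hc a b hx
    refine zeta_le_of_lt hβ hc h0 hζ (uIcc_subset_range hc a b hy) ?_
    rwa [apply_pseudoInv hβ hc h0 hx']

/-- `ζ a` is a subgradient of `B` at `β a`. -/
theorem primitiveB_subgradient (hβ : Monotone β) (hc : Continuous β) (h0 : β 0 = 0)
    (hζ : Monotone ζ) (a c : ℝ) :
    ζ a * (β c - β a) + primitiveB β ζ (β a) ≤ primitiveB β ζ (β c) := by
  have hI := intervalIntegrable_zeta_pseudoInv hβ hc h0 hζ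
  have h1 : primitiveB β ζ (β c) - primitiveB β ζ (β a) = ∫ s in β a..β c, ζ (pseudoInv β s) := by
    have ha := hI 0 a
    have hc' := hI 0 c
    rw [h0] at ha hc'
    exact intervalIntegral.integral_interval_sub_left hc' ha
  have hsub := uIcc_subset_range hc a c
  rcases le_total (β a) (β c) with h | h
  · rw [uIcc_of_le h] at hsub
    have h2 : ∫ _ in β a..β c, ζ a ≤ ∫ s in β a..β c, ζ (pseudoInv β s) := by
      refine intervalIntegral.integral_mono_on_of_le_Ioo h (by simp) (hI a c) fun s hs => ?_
      exact zeta_le_of_lt hβ hc h0 hζ (hsub (Ioo_subset_Icc_self hs)) hs.1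
    rw [intervalIntegral.integral_const, smul_eq_mul] at h2
    linarith
  · rw [uIcc_of_ge h] at hsub
    have h2 : ∫ s in β c..β a, ζ (pseudoInv β s) ≤ ∫ _ in β c..β a, ζ a := by
      refine intervalIntegral.integral_mono_on_of_le_Ioo h (hI c a) (by simp) fun s hs => ?_
      exact le_zeta_of_lt hβ hc h0 hζ (hsub (Ioo_subset_Icc_self hs)) hs.2
    rw [intervalIntegral.integral_const, smul_eq_mul] at h2
    rw [intervalIntegral.integral_symm] at h1
    linarith

theorem primitiveB_nonneg (hβ : Monotone β) (hc : Continuous β) (h0 : β 0 = 0)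
    (hζ : Monotone ζ) (hζ0 : ζ 0 = 0) (c : ℝ) : 0 ≤ primitiveB β ζ (β c) := by
  have := primitiveB_subgradient hβ hc h0 hζ 0 c
  simpa [hζ0, h0, primitiveB] using this

/-- The upper envelope of the affine minorants `z ↦ ζ a * (z - β a) + B (β a)` of `B`. It is
convex and lower semicontinuous, agrees with `B` on the closure of the range of `β`, and is `∞`
elsewhere when `ζ` is coercive. -/
def envelopeB (β ζ : ℝ → ℝ) (z : ℝ) : ℝ≥0∞ :=
  ⨆ a : ℝ, ENNReal.ofReal (ζ a * (z - β a) + primitiveB β ζ (β a))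

theorem le_envelopeB (a z : ℝ) :
    ENNReal.ofReal (ζ a * (z - β a) + primitiveB β ζ (β a)) ≤ envelopeB β ζ z :=
  le_iSup (fun a : ℝ => ENNReal.ofReal (ζ a * (z - β a) + primitiveB β ζ (β a))) a

theorem affine_le_toReal_envelopeB (a : ℝ) {z : ℝ} (hz : envelopeB β ζ z ≠ ∞) :
    ζ a * (z - β a) + primitiveB β ζ (β a) ≤ (envelopeB β ζ z).toReal :=
  (ENNReal.ofReal_le_iff_le_toReal hz).1 (le_envelopeB a z)

theorem lowerSemicontinuous_envelopeB : LowerSemicontinuous (envelopeB β ζ) :=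
  lowerSemicontinuous_iSup fun a => (ENNReal.continuous_ofReal.comp (by fun_prop)).lowerSemicontinuous

theorem measurable_envelopeB : Measurable (envelopeB β ζ) :=
  lowerSemicontinuous_envelopeB.measurable

theorem envelopeB_convex {x y θ η : ℝ} (hθ : 0 ≤ θ) (hη : 0 ≤ η) (h : θ + η = 1) :
    envelopeB β ζ (θ * x + η * y) ≤
      ENNReal.ofReal θ * envelopeB β ζ x + ENNReal.ofReal η * envelopeB β ζ y := by
  refine iSup_le fun a => ?_
  have h1 : ζ a * (θ * x + η * y - β a) + primitiveB β ζ (β a) =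
      θ * (ζ a * (x - β a) + primitiveB β ζ (β a)) +
        η * (ζ a * (y - β a) + primitiveB β ζ (β a)) := by
    obtain rfl : η = 1 - θ := by linarith
    ring
  rw [h1]
  refine ENNReal.ofReal_add_le.trans ?_
  rw [ENNReal.ofReal_mul hθ, ENNReal.ofReal_mul hη]
  gcongr <;> exact le_envelopeB _ _

theorem envelopeB_apply (hβ : Monotone β) (hc : Continuous β) (h0 : β 0 = 0)
    (hζ : Monotone ζ) (c : ℝ) : envelopeB β ζ (β c) = ENNReal.ofReal (primitiveB β ζ (β c)) := by
  refine le_antisymm (iSup_le fun a => ?_) ?_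
  · exact ENNReal.ofReal_le_ofReal (primitiveB_subgradient hβ hc h0 hζ a c)
  · simpa using le_envelopeB (β := β) (ζ := ζ) c (β c)

theorem envelopeB_eq_functionB (hβ : Monotone β) (hc : Continuous β) (h0 : β 0 = 0)
    (hζ : Monotone ζ) (hζ0 : ζ 0 = 0) {z : ℝ} (hz : z ∈ closure (range β)) :
    envelopeB β ζ z = functionB β ζ z := by
  unfold functionB
  split_ifs with h
  · obtain ⟨c, rfl⟩ := h
    exact envelopeB_apply hβ hc h0 hζ c
  · have hne : (𝓝[range β] z).NeBot := mem_closure_iff_nhdsWithin_neBot.1 hz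
    refine (Tendsto.limUnder_eq ?_).symm
    have hoc : OrdConnected (range β) := (isPreconnected_range hc).ordConnected
    have h0mem : (0 : ℝ) ∈ range β := ⟨0, h0⟩
    -- The range is an interval containing `0` but not `z`, so its points lie on the side of `z`
    -- towards `0`. For `β a` on the same side of `0` as `z`, the slope `ζ a` and `z - β a`
    -- therefore have the same sign, and the affine minorant at `a` is at least `B (β a)` at `z`.
    have hle : ∀ᶠ y in 𝓝[range β] z, ENNReal.ofReal (primitiveB β ζ y) ≤ envelopeB β ζ z := by
      have key : ∀ a, 0 ≤ ζ a * (z - β a) →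
          ENNReal.ofReal (primitiveB β ζ (β a)) ≤ envelopeB β ζ z := fun a ha =>
        (ENNReal.ofReal_le_ofReal (by linarith)).trans (le_envelopeB a z)
      rcases lt_trichotomy z 0 with hz0 | rfl | hz0
      · filter_upwards [self_mem_nhdsWithin, mem_nhdsWithin_of_mem_nhds (Iio_mem_nhds hz0)]
        rintro y ⟨a, rfl⟩ hy
        refine key a (mul_nonneg_of_nonpos_of_nonpos ?_ ?_)
        · rw [← hζ0]
          refine hζ (le_of_not_gt fun ha => ?_)
          have := hβ ha.le
          rw [h0] at this
          exact absurd hy (not_lt.2 this)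
        · by_contra! h'
          exact h (hoc.out ⟨a, rfl⟩ h0mem ⟨by linarith, hz0.le⟩)
      · exact absurd h0mem h
      · filter_upwards [self_mem_nhdsWithin, mem_nhdsWithin_of_mem_nhds (Ioi_mem_nhds hz0)]
        rintro y ⟨a, rfl⟩ hy
        refine key a (mul_nonneg ?_ ?_)
        · rw [← hζ0]
          refine hζ (le_of_not_gt fun ha => ?_)
          have := hβ ha.le
          rw [h0] at this
          exact absurd hy (not_lt.2 this)
        · by_contra! h'
          exact h (hoc.out h0mem ⟨a, rfl⟩ ⟨hz0.le, by linarith⟩)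
    refine tendsto_order.2 ⟨fun c hcz => ?_, fun c hcz => hle.mono fun y hy => hy.trans_lt hcz⟩
    -- The lower bound for the limit is the lower semicontinuity of the envelope.
    filter_upwards [self_mem_nhdsWithin, mem_nhdsWithin_of_mem_nhds
      (lowerSemicontinuous_envelopeB z c hcz)]
    rintro y ⟨a, rfl⟩ hy
    rwa [envelopeB_apply hβ hc h0 hζ] at hy

/-- Coercivity supplies minorants of arbitrarily large slope `ζ (±R)`, touching `B` at points that
stay at distance at least `ε` from `z`; since `B ≥ 0`, their values at `z` are unbounded. -/
theorem envelopeB_eq_top (hβ : Monotone β) (hc : Continuous β) (h0 : β 0 = 0)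
    (hζ : Monotone ζ) (hζ0 : ζ 0 = 0) {M₀ M₁ : ℝ} (hM₀ : 0 < M₀)
    (hζc : ∀ s : ℝ, M₀ * |s| - M₁ ≤ |ζ s|) {z : ℝ} (hz : z ∉ closure (range β)) :
    envelopeB β ζ z = ∞ := by
  have hoc : OrdConnected (range β) := (isPreconnected_range hc).ordConnected
  have h0mem : (0 : ℝ) ∈ range β := ⟨0, h0⟩
  have hzr : z ∉ range β := fun h => hz (subset_closure h)
  obtain ⟨ε, hε, hdist⟩ : ∃ ε > 0, ∀ a, ε ≤ |z - β a| := by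
    rw [Metric.mem_closure_iff] at hz
    push Not at hz
    obtain ⟨ε, hε, h⟩ := hz
    exact ⟨ε, hε, fun a => h _ ⟨a, rfl⟩⟩
  refine ENNReal.eq_top_of_forall_nnreal_le fun r => ?_
  obtain ⟨R, hR0, hR⟩ : ∃ R : ℝ, 0 ≤ R ∧ (r : ℝ) ≤ (M₀ * R - M₁) * ε := by
    refine ⟨|(r / ε + M₁) / M₀|, abs_nonneg _, ?_⟩
    have h1 := le_abs_self ((r / ε + M₁) / M₀)
    rw [div_le_iff₀ hM₀] at h1
    have h2 : (r : ℝ) / ε ≤ M₀ * |(r / ε + M₁) / M₀| - M₁ := by linarith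
    calc (r : ℝ) = r / ε * ε := by field_simp
      _ ≤ _ := by gcongr
  have key : ∀ a, |a| = R → 0 ≤ ζ a * (z - β a) → (r : ℝ≥0∞) ≤ envelopeB β ζ z := by
    intro a ha hs
    refine le_trans ?_ (le_envelopeB a z)
    rw [← ENNReal.ofReal_coe_nnreal]
    refine ENNReal.ofReal_le_ofReal ?_
    have h1 := primitiveB_nonneg hβ hc h0 hζ hζ0 a
    have h2 : (M₀ * R - M₁) * ε ≤ |ζ a| * |z - β a| := by
      refine (mul_le_mul_of_nonneg_right ?_ hε.le).trans
        (mul_le_mul_of_nonneg_left (hdist a) (abs_nonneg _))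
      rw [← ha]
      exact hζc a
    rw [← abs_mul, abs_of_nonneg hs] at h2
    linarith
  rcases lt_or_ge z 0 with hz0 | hz0
  · refine key (-R) (by rw [abs_neg, abs_of_nonneg hR0]) (mul_nonneg_of_nonpos_of_nonpos ?_ ?_)
    · rw [← hζ0]
      exact hζ (by linarith)
    · by_contra! h'
      exact hzr (hoc.out ⟨-R, rfl⟩ h0mem ⟨by linarith, hz0.le⟩)
  · refine key R (abs_of_nonneg hR0) (mul_nonneg ?_ ?_)
    · rw [← hζ0]
      exact hζ hR0
    · by_contra! h'
      exact hzr (hoc.out h0mem ⟨R, rfl⟩ ⟨hz0, by linarith⟩)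

end Envelope

/-! ### Smooth truncations of the real line -/

section SmoothTruncation

/-- A smooth bounded odd increasing function, which tends to the identity as `e → 0`. -/
def truncArctan (e s : ℝ) : ℝ := e⁻¹ * Real.arctan (e * s)

/-- The derivative of `truncArctan e`. -/
def truncArctanDeriv (e s : ℝ) : ℝ := (1 + (e * s) ^ 2)⁻¹

theorem hasDerivAt_truncArctan {e : ℝ} (he : e ≠ 0) (s : ℝ) :
    HasDerivAt (truncArctan e) (truncArctanDeriv e s) s := by
  have h1 : HasDerivAt (fun s => e * s) e s := by simpa using (hasDerivAt_id s).const_mul e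
  refine ((h1.arctan).const_mul e⁻¹).congr_deriv ?_
  unfold truncArctanDeriv
  field_simp

theorem truncArctanDeriv_nonneg (e s : ℝ) : 0 ≤ truncArctanDeriv e s := by
  unfold truncArctanDeriv
  positivity

theorem truncArctanDeriv_le_one (e s : ℝ) : truncArctanDeriv e s ≤ 1 :=
  inv_le_one_of_one_le₀ (by nlinarith [sq_nonneg (e * s)])

theorem continuous_truncArctan (e : ℝ) : Continuous (truncArctan e) := by
  unfold truncArctan
  fun_prop

theorem contDiff_truncArctan (e : ℝ) {n : ℕ∞} : ContDiff ℝ n (truncArctan e) := by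
  unfold truncArctan
  exact contDiff_const.mul (Real.contDiff_arctan.comp (contDiff_const.mul contDiff_id))

theorem continuous_truncArctanDeriv (e : ℝ) : Continuous (truncArctanDeriv e) := by
  unfold truncArctanDeriv
  exact Continuous.inv₀ (by fun_prop) fun s => by positivity

@[simp] theorem truncArctan_zero (e : ℝ) : truncArctan e 0 = 0 := by simp [truncArctan]

theorem lipschitzWith_truncArctan {e : ℝ} (he : e ≠ 0) : LipschitzWith 1 (truncArctan e) := by
  refine lipschitzWith_of_nnnorm_deriv_le
    (fun s => (hasDerivAt_truncArctan he s).differentiableAt) fun s => ?_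
  rw [(hasDerivAt_truncArctan he s).deriv, ← NNReal.coe_le_coe, coe_nnnorm, Real.norm_eq_abs,
    abs_of_nonneg (truncArctanDeriv_nonneg e s)]
  exact truncArctanDeriv_le_one e s

theorem abs_truncArctan_sub_le {e : ℝ} (he : e ≠ 0) (s t : ℝ) :
    |truncArctan e s - truncArctan e t| ≤ |s - t| := by
  simpa [Real.dist_eq] using (lipschitzWith_truncArctan he).dist_le_mul s t

theorem abs_truncArctan_le {e : ℝ} (he : e ≠ 0) (s : ℝ) : |truncArctan e s| ≤ |s| := by
  simpa using abs_truncArctan_sub_le he s 0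

theorem monotone_truncArctan {e : ℝ} (he : e ≠ 0) : Monotone (truncArctan e) :=
  monotone_of_deriv_nonneg (fun s => (hasDerivAt_truncArctan he s).differentiableAt) fun s => by
    rw [(hasDerivAt_truncArctan he s).deriv]
    exact truncArctanDeriv_nonneg e s

theorem abs_truncArctan_le_const {e : ℝ} (he : 0 < e) (s : ℝ) :
    |truncArctan e s| ≤ e⁻¹ * (Real.pi / 2) := by
  unfold truncArctan
  rw [abs_mul, abs_of_pos (inv_pos.2 he)]
  gcongr
  exact abs_le.2 ⟨(Real.neg_pi_div_two_lt_arctan _).le, (Real.arctan_lt_pi_div_two _).le⟩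

theorem tendsto_truncArctan (s : ℝ) :
    Tendsto (fun e => truncArctan e s) (𝓝[>] 0) (𝓝 s) := by
  have h1 : HasDerivAt (fun e => e * s) s 0 := by simpa using (hasDerivAt_id (0 : ℝ)).mul_const s
  have h2 := h1.arctan
  rw [hasDerivAt_iff_tendsto_slope] at h2
  have h3 := h2.mono_left (nhdsWithin_mono (0 : ℝ) (fun x (hx : x ∈ Ioi 0) => ne_of_gt hx))
  simpa [slope_fun_def, truncArctan] using h3

theorem tendsto_truncArctanDeriv (s : ℝ) :
    Tendsto (fun e => truncArctanDeriv e s) (𝓝[>] 0) (𝓝 1) := by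
  have h : Continuous fun e => truncArctanDeriv e s := by
    unfold truncArctanDeriv
    exact Continuous.inv₀ (by fun_prop) fun s => by positivity
  have := h.tendsto 0
  simp only [truncArctanDeriv, zero_mul] at this
  norm_num at this
  exact this.mono_left nhdsWithin_le_nhds

/-- The quotient `truncArctan e s / s`, continued by `1` at `0`. -/
def truncRatio (e s : ℝ) : ℝ := if s = 0 then 1 else truncArctan e s / s

theorem measurable_truncRatio (e : ℝ) : Measurable (truncRatio e) :=
  Measurable.ite (measurableSet_singleton 0) measurable_const
    ((continuous_truncArctan e).measurable.div measurable_id)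

theorem truncRatio_mul (e s : ℝ) : truncRatio e s * s = truncArctan e s := by
  unfold truncRatio
  split_ifs with h
  · simp [h]
  · field_simp

theorem truncRatio_nonneg {e : ℝ} (he : e ≠ 0) (s : ℝ) : 0 ≤ truncRatio e s := by
  unfold truncRatio
  split_ifs with h
  · exact zero_le_one
  · rcases le_total 0 s with hs | hs
    · exact div_nonneg (by simpa using monotone_truncArctan he hs) hs
    · exact div_nonneg_of_nonpos (by simpa using monotone_truncArctan he hs) hs

theorem truncRatio_le_one {e : ℝ} (he : e ≠ 0) (s : ℝ) : truncRatio e s ≤ 1 := by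
  unfold truncRatio
  split_ifs with h
  · exact le_rfl
  · refine (le_abs_self _).trans ?_
    rw [abs_div]
    exact div_le_one_of_le₀ (abs_truncArctan_le he s) (abs_nonneg s)

theorem tendsto_truncRatio (s : ℝ) :
    Tendsto (fun e => truncRatio e s) (𝓝[>] 0) (𝓝 1) := by
  unfold truncRatio
  split_ifs with h
  · exact tendsto_const_nhds
  · have := (tendsto_truncArctan s).div_const s
    rwa [div_self h] at this

end SmoothTruncation

/-! ### Dominated convergence in `L^p` -/

section DominatedConvergence

theorem tendsto_eLpNorm_zero_of_dominated {α E : Type*} [MeasurableSpace α] {μ : Measure α}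
    [NormedAddCommGroup E] {p : ℝ≥0∞} (hp0 : p ≠ 0)
    (hp : p ≠ ∞) {F : ℕ → α → E} {g : α → ℝ}
    (hF : ∀ i, AEStronglyMeasurable (F i) μ) (hg : MemLp g p μ)
    (hle : ∀ i, ∀ᵐ x ∂μ, ‖F i x‖ ≤ g x)
    (hlim : ∀ᵐ x ∂μ, Tendsto (fun i => F i x) atTop (𝓝 0)) :
    Tendsto (fun i => eLpNorm (F i) p μ) atTop (𝓝 0) := by
  have hpr : 0 < p.toReal := ENNReal.toReal_pos hp0 hp
  simp only [eLpNorm_eq_lintegral_rpow_enorm_toReal hp0 hp]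
  have h1 : Tendsto (fun i => ∫⁻ x, ‖F i x‖ₑ ^ p.toReal ∂μ) atTop (𝓝 (∫⁻ _, 0 ∂μ)) := by
    refine tendsto_lintegral_of_dominated_convergence' (fun x => ‖g x‖ₑ ^ p.toReal)
      (fun i => (hF i).enorm.pow_const _) (fun i => ?_) ?_ ?_
    · filter_upwards [hle i] with x hx
      gcongr
      rw [← ofReal_norm, ← ofReal_norm]
      exact ENNReal.ofReal_le_ofReal (hx.trans (le_abs_self _))
    · exact (lintegral_rpow_enorm_lt_top_of_eLpNorm_lt_top hp0 hp hg.2).ne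
    · filter_upwards [hlim] with x hx
      have h2 := (ENNReal.continuous_rpow_const (y := p.toReal)).tendsto 0 |>.comp
        (continuous_enorm.tendsto (0 : E) |>.comp hx |> fun h => by simpa using h)
      simpa [ENNReal.zero_rpow_of_pos hpr, Function.comp_def] using h2
  rw [lintegral_zero] at h1
  have h3 := ((ENNReal.continuous_rpow_const (y := 1 / p.toReal)).tendsto 0).comp h1
  rwa [ENNReal.zero_rpow_of_pos (by positivity)] at h3

end DominatedConvergence

/-! ### Truncation in `W^{1,p}_0` and the Brezis–Browder inequality -/

section Truncation

variable {d : ℕ} {Ω : Opens (EuclideanSpace ℝ (Fin d))} {p : ℝ≥0∞}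

/-- The smooth truncation of a test function. -/
def truncTest (e : ℝ) (γ : 𝓓(Ω, ℝ)) : 𝓓(Ω, ℝ) where
  toFun := truncArctan e ∘ γ
  contDiff' := (contDiff_truncArctan e).comp γ.contDiff
  hasCompactSupport' := γ.hasCompactSupport.comp_left (truncArctan_zero e)
  tsupport_subset' :=
    (tsupport_comp_subset (truncArctan_zero e) γ).trans γ.tsupport_subset

theorem gradient_truncTest {e : ℝ} (he : e ≠ 0) (γ : 𝓓(Ω, ℝ)) (x : EuclideanSpace ℝ (Fin d)) :
    gradient (truncTest e γ) x = truncArctanDeriv e (γ x) • gradient γ x := by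
  have h1 : HasFDerivAt γ (fderiv ℝ γ x) x := (γ.contDiff.differentiable (by simp) x).hasFDerivAt
  have h2 := (hasDerivAt_truncArctan he (γ x)).comp_hasFDerivAt x h1
  unfold gradient
  rw [show fderiv ℝ (truncTest e γ) x = truncArctanDeriv e (γ x) • fderiv ℝ γ x from h2.fderiv,
    map_smul]

theorem memLp_truncArctan {e : ℝ} (he : e ≠ 0)
    {u : EuclideanSpace ℝ (Fin d) → ℝ} {μ : Measure (EuclideanSpace ℝ (Fin d))}
    (hu : MemLp u p μ) : MemLp (fun x => truncArctan e (u x)) p μ :=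
  hu.mono ((continuous_truncArctan e).comp_aestronglyMeasurable hu.1)
    (Eventually.of_forall fun x => abs_truncArctan_le he (u x))

theorem memLp_truncArctanDeriv_smul (e : ℝ) {u : EuclideanSpace ℝ (Fin d) → ℝ}
    {g : EuclideanSpace ℝ (Fin d) → EuclideanSpace ℝ (Fin d)}
    {μ : Measure (EuclideanSpace ℝ (Fin d))} (hu : AEStronglyMeasurable u μ) (hg : MemLp g p μ) :
    MemLp (fun x => truncArctanDeriv e (u x) • g x) p μ := by
  refine hg.mono (((continuous_truncArctanDeriv e).comp_aestronglyMeasurable hu).smul hg.1)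
    (Eventually.of_forall fun x => ?_)
  rw [norm_smul, Real.norm_eq_abs, abs_of_nonneg (truncArctanDeriv_nonneg _ _)]
  exact mul_le_of_le_one_left (norm_nonneg _) (truncArctanDeriv_le_one _ _)

variable [Fact (1 ≤ p)]

/-- The truncation `(S(u), S'(u)∇u)` of a pair `(u, ∇u)`. -/
def truncPair {e : ℝ} (he : e ≠ 0) (u : SobolevPair Ω p) : SobolevPair Ω p :=
  ((memLp_truncArctan he (Lp.memLp u.1)).toLp,
    (memLp_truncArctanDeriv_smul e (Lp.memLp u.1).1 (Lp.memLp u.2)).toLp)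

theorem tendsto_toLp_iff {α E : Type*} [MeasurableSpace α] {μ : Measure α} [NormedAddCommGroup E]
    {F : ℕ → α → E} {f : α → E} (hF : ∀ n, MemLp (F n) p μ) (hf : MemLp f p μ) :
    Tendsto (fun n => (hF n).toLp) atTop (𝓝 hf.toLp) ↔
      Tendsto (fun n => eLpNorm (F n - f) p μ) atTop (𝓝 0) :=
  Lp.tendsto_Lp_iff_tendsto_eLpNorm'' F hF f hf

/-- This places the truncation of an element of `W^{1,p}_0` in `W^{1,p}_0`. The functions converge
because the truncation is 1-Lipschitz; the gradients need the almost-everywhere convergence, since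
the factor `S'(γ n)` varies with `n`. -/
theorem tendsto_testPair_truncTest (hp : p ≠ ∞) {e : ℝ} (he : e ≠ 0) {γ : ℕ → 𝓓(Ω, ℝ)}
    {u : SobolevPair Ω p} (hγ : Tendsto (fun n => testPair Ω p (γ n)) atTop (𝓝 u))
    (hae : ∀ᵐ x ∂(volume.restrict (Ω : Set (EuclideanSpace ℝ (Fin d)))),
      Tendsto (fun n => γ n x) atTop (𝓝 (u.1 x))) :
    Tendsto (fun n => testPair Ω p (truncTest e (γ n))) atTop (𝓝 (truncPair he u)) := by
  have hp0 : p ≠ 0 := (zero_lt_one.trans_le (Fact.out : 1 ≤ p)).ne'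
  set μ := volume.restrict (Ω : Set (EuclideanSpace ℝ (Fin d)))
  have hu1 := Lp.memLp u.1
  have hu2 := Lp.memLp u.2
  have h1 : Tendsto (fun n => eLpNorm (⇑(γ n) - ⇑u.1) p μ) atTop (𝓝 0) := by
    rw [← tendsto_toLp_iff (fun n => testFunction_memLp Ω p (γ n)) hu1, Lp.toLp_coeFn]
    exact (continuous_fst.tendsto u).comp hγ
  have h2 : Tendsto (fun n => eLpNorm (gradient (γ n) - ⇑u.2) p μ) atTop (𝓝 0) := by
    rw [← tendsto_toLp_iff (fun n => gradient_testFunction_memLp Ω p (γ n)) hu2, Lp.toLp_coeFn]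
    exact (continuous_snd.tendsto u).comp hγ
  refine Tendsto.prodMk_nhds ?_ ?_
  · refine (tendsto_toLp_iff (fun n => testFunction_memLp Ω p (truncTest e (γ n)))
      (memLp_truncArctan he hu1)).2 ?_
    refine tendsto_of_tendsto_of_tendsto_of_le_of_le tendsto_const_nhds h1 (fun _ => zero_le)
      fun n => eLpNorm_mono fun x => ?_
    exact abs_truncArctan_sub_le he (γ n x) (u.1 x)
  · refine (tendsto_toLp_iff (fun n => gradient_testFunction_memLp Ω p (truncTest e (γ n)))
      (memLp_truncArctanDeriv_smul e hu1.1 hu2)).2 ?_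
    have hms : ∀ n, AEStronglyMeasurable (fun x => truncArctanDeriv e (γ n x)) μ := fun n =>
      ((continuous_truncArctanDeriv e).comp (γ n).continuous).aestronglyMeasurable
    have hF : ∀ n, AEStronglyMeasurable
        (fun x => (truncArctanDeriv e (γ n x) - truncArctanDeriv e (u.1 x)) • u.2 x) μ := fun n =>
      ((hms n).sub ((continuous_truncArctanDeriv e).comp_aestronglyMeasurable hu1.1)).smul hu2.1
    have hG : ∀ n, AEStronglyMeasurable
        (fun x => truncArctanDeriv e (γ n x) • (gradient (γ n) x - u.2 x)) μ := fun n =>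
      (hms n).smul ((gradient_testFunction_memLp Ω p (γ n)).1.sub hu2.1)
    have h3 : Tendsto (fun n => eLpNorm
        (fun x => (truncArctanDeriv e (γ n x) - truncArctanDeriv e (u.1 x)) • u.2 x) p μ)
        atTop (𝓝 0) := by
      refine tendsto_eLpNorm_zero_of_dominated hp0 hp hF hu2.norm
        (fun n => Eventually.of_forall fun x => ?_) ?_
      · rw [norm_smul, Real.norm_eq_abs]
        refine mul_le_of_le_one_left (norm_nonneg _) (abs_le.2 ⟨?_, ?_⟩) <;>
          linarith [truncArctanDeriv_nonneg e (γ n x), truncArctanDeriv_le_one e (γ n x),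
            truncArctanDeriv_nonneg e (u.1 x), truncArctanDeriv_le_one e (u.1 x)]
      · filter_upwards [hae] with x hx
        have h4 := ((continuous_truncArctanDeriv e).tendsto _).comp hx
        have h5 := (h4.sub_const (truncArctanDeriv e (u.1 x))).smul_const (u.2 x)
        simpa using h5
    have h4 := h2.add h3
    rw [add_zero] at h4
    refine tendsto_of_tendsto_of_tendsto_of_le_of_le tendsto_const_nhds h4 (fun _ => zero_le)
      fun n => ?_
    -- The first term is small because `0 ≤ S' ≤ 1`, the second by dominated convergence.
    have h5 : gradient (truncTest e (γ n)) - (fun x => truncArctanDeriv e (u.1 x) • u.2 x) =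
        (fun x => truncArctanDeriv e (γ n x) • (gradient (γ n) x - u.2 x)) +
        fun x => (truncArctanDeriv e (γ n x) - truncArctanDeriv e (u.1 x)) • u.2 x := by
      funext x
      simp only [Pi.sub_apply, Pi.add_apply, gradient_truncTest he, smul_sub, sub_smul]
      abel
    rw [h5]
    refine (eLpNorm_add_le (hG n) (hF n) Fact.out).trans ?_
    gcongr
    refine eLpNorm_mono fun x => ?_
    rw [norm_smul, Real.norm_eq_abs, abs_of_nonneg (truncArctanDeriv_nonneg _ _)]
    exact mul_le_of_le_one_left (norm_nonneg _) (truncArctanDeriv_le_one _ _)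

theorem tendsto_truncPair (hp : p ≠ ∞) {e : ℕ → ℝ} (he : ∀ n, e n ≠ 0)
    (hlim : Tendsto e atTop (𝓝[>] 0)) (u : SobolevPair Ω p) :
    Tendsto (fun n => truncPair (he n) u) atTop (𝓝 u) := by
  have hp0 : p ≠ 0 := (zero_lt_one.trans_le (Fact.out : 1 ≤ p)).ne'
  have hu1 := Lp.memLp u.1
  have hu2 := Lp.memLp u.2
  refine Tendsto.prodMk_nhds ?_ ?_
  · have := (tendsto_toLp_iff (fun n => memLp_truncArctan (he n) hu1) hu1).2 ?_
    · rwa [Lp.toLp_coeFn] at this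
    refine tendsto_eLpNorm_zero_of_dominated (g := fun x => 2 * ‖u.1 x‖) hp0 hp
      (fun n => ((memLp_truncArctan (he n) hu1).sub hu1).1) (hu1.norm.const_mul 2)
      (fun n => Eventually.of_forall fun x => ?_) (Eventually.of_forall fun x => ?_)
    · refine (norm_sub_le _ _).trans ?_
      have := abs_truncArctan_le (he n) (u.1 x)
      simp only [Real.norm_eq_abs]
      linarith
    · have := ((tendsto_truncArctan (u.1 x)).comp hlim).sub_const (u.1 x)
      simpa using this
  · have := (tendsto_toLp_iff (fun n => memLp_truncArctanDeriv_smul (e n) hu1.1 hu2) hu2).2 ?_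
    · rwa [Lp.toLp_coeFn] at this
    refine tendsto_eLpNorm_zero_of_dominated (g := fun x => 2 * ‖u.2 x‖) hp0 hp
      (fun n => ((memLp_truncArctanDeriv_smul (e n) hu1.1 hu2).sub hu2).1) (hu2.norm.const_mul 2)
      (fun n => Eventually.of_forall fun x => ?_) (Eventually.of_forall fun x => ?_)
    · refine (norm_sub_le _ _).trans ?_
      have h1 : ‖truncArctanDeriv (e n) (u.1 x) • u.2 x‖ ≤ ‖u.2 x‖ := by
        rw [norm_smul, Real.norm_eq_abs, abs_of_nonneg (truncArctanDeriv_nonneg _ _)]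
        exact mul_le_of_le_one_left (norm_nonneg _) (truncArctanDeriv_le_one _ _)
      linarith
    · have := (((tendsto_truncArctanDeriv (u.1 x)).comp hlim).smul_const (u.2 x)).sub_const (u.2 x)
      simpa using this

/-- A one-sided Brezis–Browder theorem: if the element `ℓ` of `W^{-1,p'}(Ω)` is the integrable
function `f`, and if `f u` has an integrable minorant, then the integral of the minorant is at most
`⟨ℓ, u⟩`. -/
theorem integral_le_of_le_mul (hp : p ≠ ∞) {ℓ : StrongDual ℝ (W0 Ω p)}
    {f g : EuclideanSpace ℝ (Fin d) → ℝ}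
    (hf : Integrable f (volume.restrict (Ω : Set (EuclideanSpace ℝ (Fin d)))))
    (hg : Integrable g (volume.restrict (Ω : Set (EuclideanSpace ℝ (Fin d)))))
    (hℓ : ∀ γ : 𝓓(Ω, ℝ),
      ℓ (testW0 Ω p γ) = ∫ x in (Ω : Set (EuclideanSpace ℝ (Fin d))), f x * γ x)
    (u : W0 Ω p)
    (hle : ∀ᵐ x ∂(volume.restrict (Ω : Set (EuclideanSpace ℝ (Fin d)))), g x ≤ f x * u.1.1 x) :
    ∫ x in (Ω : Set (EuclideanSpace ℝ (Fin d))), g x ≤ ℓ u := by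
  set μ := volume.restrict (Ω : Set (EuclideanSpace ℝ (Fin d))) with hμ
  have hu1 := Lp.memLp u.1.1
  -- Approximating test functions, passed to a subsequence that also converges almost everywhere.
  obtain ⟨γ, hγ, hae⟩ : ∃ γ : ℕ → 𝓓(Ω, ℝ),
      Tendsto (fun n => testPair Ω p (γ n)) atTop (𝓝 u.1) ∧
      ∀ᵐ x ∂μ, Tendsto (fun n => γ n x) atTop (𝓝 (u.1.1 x)) := by
    have hu : u.1 ∈ closure (LinearMap.range (testPair Ω p) : Set (SobolevPair Ω p)) := u.2
    obtain ⟨y, hy, hylim⟩ := mem_closure_iff_seq_limit.1 hu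
    choose γ hγ using hy
    obtain rfl : y = fun n => testPair Ω p (γ n) := funext fun n => (hγ n).symm
    have h1 : Tendsto (fun n => (testPair Ω p (γ n)).1) atTop (𝓝 u.1.1) :=
      (continuous_fst.tendsto u.1).comp hylim
    obtain ⟨ns, hns, hns'⟩ := (tendstoInMeasure_of_tendsto_Lp h1).exists_seq_tendsto_ae
    refine ⟨fun n => γ (ns n), hylim.comp hns.tendsto_atTop, ?_⟩
    have h2 : ∀ᵐ x ∂μ, ∀ n, (testPair Ω p (γ n)).1 x = γ n x :=
      ae_all_iff.2 fun n => (testFunction_memLp Ω p (γ n)).coeFn_toLp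
    filter_upwards [hns', h2] with x hx hx2
    simpa only [hx2] using hx
  have hmem : ∀ {e : ℝ} (he : e ≠ 0), truncPair he u.1 ∈ W0 Ω p := fun he =>
    mem_closure_of_tendsto (tendsto_testPair_truncTest hp he hγ hae)
      (Eventually.of_forall fun n => ⟨_, rfl⟩)
  -- A truncated function is bounded, so its product with `f` is integrable and the representation
  -- of `ℓ` extends to it.
  have hval : ∀ {e : ℝ} (he : 0 < e),
      ℓ ⟨truncPair he.ne' u.1, hmem he.ne'⟩ = ∫ x, f x * truncArctan e (u.1.1 x) ∂μ := by
    intro e he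
    have h1 : Tendsto (fun n => testW0 Ω p (truncTest e (γ n))) atTop
        (𝓝 ⟨truncPair he.ne' u.1, hmem he.ne'⟩) :=
      tendsto_subtype_rng.2 (tendsto_testPair_truncTest hp he.ne' hγ hae)
    have h2 := (ℓ.continuous.tendsto _).comp h1
    refine tendsto_nhds_unique h2 ?_
    simp only [Function.comp_def, hℓ]
    refine tendsto_integral_of_dominated_convergence
      (fun x => ‖f x‖ * (e⁻¹ * (Real.pi / 2)))
      (fun n => hf.1.mul (truncTest e (γ n)).continuous.aestronglyMeasurable)
      (hf.norm.mul_const _) (fun n => Eventually.of_forall fun x => ?_) ?_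
    · rw [norm_mul]
      gcongr
      exact abs_truncArctan_le_const he _
    · filter_upwards [hae] with x hx
      exact (((continuous_truncArctan e).tendsto _).comp hx).const_mul (f x)
  set e : ℕ → ℝ := fun n => 1 / ((n : ℝ) + 1) with he_def
  have he : ∀ n, 0 < e n := fun n => by positivity
  have helim : Tendsto e atTop (𝓝[>] 0) :=
    tendsto_nhdsWithin_iff.2
      ⟨tendsto_one_div_add_atTop_nhds_zero_nat, Eventually.of_forall fun n => he n⟩
  have hr : Tendsto (fun n => ℓ ⟨truncPair (he n).ne' u.1, hmem (he n).ne'⟩) atTop (𝓝 (ℓ u)) :=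
    (ℓ.continuous.tendsto u).comp
      (tendsto_subtype_rng.2 (tendsto_truncPair hp (fun n => (he n).ne') helim u.1))
  have hmeas : ∀ n, AEStronglyMeasurable (fun x => truncRatio (e n) (u.1.1 x) * g x) μ := fun n =>
    (((measurable_truncRatio (e n)).comp_aemeasurable hu1.1.aemeasurable).aestronglyMeasurable).mul
      hg.1
  have hbd : ∀ n, ∀ᵐ x ∂μ, ‖truncRatio (e n) (u.1.1 x) * g x‖ ≤ ‖g x‖ := fun n =>
    Eventually.of_forall fun x => by
      rw [norm_mul, Real.norm_eq_abs, abs_of_nonneg (truncRatio_nonneg (he n).ne' _)]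
      exact mul_le_of_le_one_left (norm_nonneg _) (truncRatio_le_one (he n).ne' _)
  have hl : Tendsto (fun n => ∫ x, truncRatio (e n) (u.1.1 x) * g x ∂μ) atTop
      (𝓝 (∫ x, g x ∂μ)) := by
    refine tendsto_integral_of_dominated_convergence (fun x => ‖g x‖) hmeas hg.norm hbd
      (Eventually.of_forall fun x => ?_)
    have := ((tendsto_truncRatio (u.1.1 x)).comp helim).mul_const (g x)
    simpa using this
  -- Multiplying `g ≤ f u` by the ratio `S(u)/u ∈ [0,1]` gives a minorant of `f S(u)` dominated by
  -- `|g|`. The right side passes to the limit through the continuity of `ℓ`, so `f u` itself never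
  -- has to be integrable.
  refine le_of_tendsto_of_tendsto' hl hr fun n => ?_
  rw [hval (he n)]
  refine integral_mono_ae (hg.mono (hmeas n) (hbd n)) ?_ ?_
  · refine (hf.norm.mul_const ((e n)⁻¹ * (Real.pi / 2))).mono'
      (hf.1.mul ((continuous_truncArctan (e n)).comp_aestronglyMeasurable hu1.1))
      (Eventually.of_forall fun x => ?_)
    rw [norm_mul]
    gcongr
    exact abs_truncArctan_le_const (he n) _
  · filter_upwards [hle] with x hx
    have h1 := mul_le_mul_of_nonneg_left hx (truncRatio_nonneg (he n).ne' (u.1.1 x))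
    refine h1.trans_eq ?_
    rw [← truncRatio_mul]
    ring

end Truncation

/-! ### Weak derivatives in time -/

section DuBoisReymond

theorem exists_Icc_of_isCompact_subset_Ioo {K : Set ℝ} {T : ℝ} (hT : 0 < T) (hK : IsCompact K)
    (hsub : K ⊆ Ioo 0 T) : ∃ a b, 0 < a ∧ b < T ∧ K ⊆ Icc a b := by
  rcases K.eq_empty_or_nonempty with rfl | hne
  · exact ⟨T / 2, T / 2, by linarith, by linarith, empty_subset _⟩
  · obtain ⟨a, ha⟩ := hK.exists_isLeast hne
    obtain ⟨b, hb⟩ := hK.exists_isGreatest hne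
    exact ⟨a, b, (hsub ha.1).1, (hsub hb.1).2, fun x hx => ⟨ha.2 hx, hb.2 hx⟩⟩

/-- A smooth function of zero mean, compactly supported in `(0,T)`, is the derivative of a test
function. -/
theorem exists_testFunction_deriv_eq {T : ℝ} (hT : 0 < T) {ψ : ℝ → ℝ} (hψ : ContDiff ℝ (⊤ : ℕ∞) ψ)
    (hcs : HasCompactSupport ψ) (hsub : tsupport ψ ⊆ Ioo 0 T) (hmean : ∫ x, ψ x = 0) :
    ∃ φ : 𝓓(timeInterval T, ℝ), deriv φ = ψ := by
  obtain ⟨a, b, ha, hb, hK⟩ := exists_Icc_of_isCompact_subset_Ioo hT hcs hsub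
  set Φ : ℝ → ℝ := fun t => ∫ x in (0 : ℝ)..t, ψ x with hΦ
  have hder : ∀ t, HasDerivAt Φ (ψ t) t := fun t => hψ.continuous.integral_hasStrictDerivAt 0 t
    |>.hasDerivAt
  have hderiv : deriv Φ = ψ := funext fun t => (hder t).deriv
  have hsm : ContDiff ℝ (⊤ : ℕ∞) Φ :=
    contDiff_infty_iff_deriv.2 ⟨fun t => (hder t).differentiableAt, by rwa [hderiv]⟩
  have hz : ∀ x, x ∉ Icc a b → ψ x = 0 := fun x hx =>
    image_eq_zero_of_notMem_tsupport fun h => hx (hK h)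
  have hsupp : Function.support Φ ⊆ Icc a b := by
    intro t ht
    by_contra hmem
    refine ht ?_
    rw [mem_Icc, not_and_or, not_le, not_le] at hmem
    -- Left of `a` the interval from `0` to `t` misses the support, as `0 < a`; right of `b` it
    -- contains the support, and the zero mean applies.
    rcases hmem with h | h
    · refine (intervalIntegral.integral_congr_ae (g := fun _ => 0)
        (Eventually.of_forall fun x hx => hz x fun hx' => ?_)).trans (by simp)
      have := hx.2
      have h3 : max 0 t < a := max_lt ha h
      linarith [hx'.1]
    · refine (intervalIntegral.integral_eq_integral_of_support_subset fun x hx => ?_).trans hmean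
      have hx' : x ∈ Icc a b := by
        by_contra h'
        exact hx (hz x h')
      exact ⟨ha.trans_le hx'.1, hx'.2.trans h.le⟩
  have hts : tsupport Φ ⊆ Icc a b := closure_minimal hsupp isClosed_Icc
  exact ⟨⟨Φ, hsm, isCompact_Icc.of_isClosed_subset (isClosed_tsupport _) hts,
    hts.trans fun x hx => ⟨ha.trans_le hx.1, hx.2.trans_lt hb⟩⟩, hderiv⟩

/-- The lemma of du Bois-Reymond: a continuous function whose distributional derivative vanishes
is constant. -/
theorem eq_const_of_integral_deriv_mul_eq_zero {T : ℝ} (hT : 0 < T) {k : ℝ → ℝ}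
    (hk : ContinuousOn k (Icc 0 T))
    (h : ∀ φ : 𝓓(timeInterval T, ℝ), ∫ t in Ioo 0 T, deriv φ t * k t = 0) :
    ∃ c, ∀ t ∈ Icc 0 T, k t = c := by
  have hki : IntegrableOn k (Icc 0 T) := hk.integrableOn_compact isCompact_Icc
  have hki' : IntegrableOn k (Ioo 0 T) := hki.mono_set Ioo_subset_Icc_self
  let bump : ContDiffBump (T / 2) := ⟨T / 8, T / 4, by linarith, by linarith⟩
  set η := bump.normed volume with hη
  have hηsub : tsupport η ⊆ Ioo 0 T := by
    rw [hη, ContDiffBump.tsupport_normed_eq, Real.closedBall_eq_Icc]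
    intro x hx
    have h1 : T / 2 - T / 4 ≤ x := hx.1
    have h2 : x ≤ T / 2 + T / 4 := hx.2
    exact ⟨by linarith, by linarith⟩
  have hηcs : HasCompactSupport η := bump.hasCompactSupport_normed
  have hηc : Continuous η := bump.continuous_normed
  have hmulint : ∀ {ψ : ℝ → ℝ}, Continuous ψ → HasCompactSupport ψ → ∀ {f : ℝ → ℝ},
      IntegrableOn f (Ioo 0 T) → IntegrableOn (fun t => ψ t * f t) (Ioo 0 T) := by
    intro ψ hψ hψc f hf
    obtain ⟨C, hC⟩ := hψc.exists_bound_of_continuous hψ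
    exact Integrable.bdd_mul hf hψ.aestronglyMeasurable (Eventually.of_forall hC)
  set c := ∫ t in Ioo 0 T, η t * k t with hc
  refine ⟨c, ?_⟩
  have hae : ∀ᵐ t, t ∈ Ioo 0 T → k t - c = 0 := by
    refine isOpen_Ioo.ae_eq_zero_of_integral_contDiff_smul_eq_zero ?_ fun ψ hψ hψc hψs => ?_
    · exact (hki'.sub (integrableOn_const (by simp))).locallyIntegrableOn
    -- Since `η` has unit mass, `ψ - m η` has zero mean and is the derivative of a test function;
    -- testing with it gives `∫ ψ (k - c) = 0`.
    · set m := ∫ x, ψ x with hm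
      have hψi : Integrable ψ := hψ.continuous.integrable_of_hasCompactSupport hψc
      have hηi : Integrable η := hηc.integrable_of_hasCompactSupport hηcs
      have hsub2 : tsupport (fun x => ψ x - m * η x) ⊆ Ioo 0 T := by
        refine (tsupport_sub ψ (fun x => m * η x)).trans (union_subset hψs ?_)
        exact (tsupport_mul_subset_right (f := fun _ => m) (g := η)).trans hηsub
      have hcs2 : HasCompactSupport (fun x => ψ x - m * η x) := by
        have : HasCompactSupport (fun x => m * η x) := hηcs.mul_left
        exact hψc.sub this
      obtain ⟨φ, hφ⟩ := exists_testFunction_deriv_eq hT (ψ := fun x => ψ x - m * η x)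
        (hψ.sub (contDiff_const.mul bump.contDiff_normed)) hcs2 hsub2 (by
          rw [integral_sub hψi (hηi.const_mul m), integral_const_mul, hη,
            ContDiffBump.integral_normed, mul_one, sub_self])
      have h1 := h φ
      rw [hφ] at h1
      have h2 : ∫ t in Ioo 0 T, (ψ t - m * η t) * k t =
          (∫ t in Ioo 0 T, ψ t * k t) - m * c := by
        rw [hc, ← integral_const_mul, ← integral_sub (hmulint hψ.continuous hψc hki')
          ((hmulint hηc hηcs hki').const_mul m)]
        exact integral_congr_ae (Eventually.of_forall fun t => by ring)
      have h3 : ∫ t, ψ t • (k t - c) = ∫ t in Ioo 0 T, ψ t • (k t - c) := by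
        refine (setIntegral_eq_integral_of_forall_compl_eq_zero fun x hx => ?_).symm
        rw [image_eq_zero_of_notMem_tsupport fun h' => hx (hψs h'), zero_smul]
      have h4 : ∫ t in Ioo 0 T, ψ t = m := by
        refine setIntegral_eq_integral_of_forall_compl_eq_zero fun x hx => ?_
        exact image_eq_zero_of_notMem_tsupport fun h' => hx (hψs h')
      rw [h3]
      simp only [smul_eq_mul, mul_sub]
      rw [integral_sub (hmulint hψ.continuous hψc hki') (hψi.integrableOn.mul_const c),
        integral_mul_const, h4]
      linarith
  have hcl : closure (Ioo 0 T) = Icc 0 T := closure_Ioo hT.ne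
  have heq : EqOn k (fun _ => c) (Ioo 0 T) := by
    have h5 : k =ᵐ[volume.restrict (Ioo 0 T)] fun _ => c := by
      rw [EventuallyEq, ae_restrict_iff' measurableSet_Ioo]
      filter_upwards [hae] with t ht hmem
      linarith [ht hmem]
    exact Measure.eqOn_open_of_ae_eq h5 isOpen_Ioo (hk.mono Ioo_subset_Icc_self)
      continuousOn_const
  exact heq.of_subset_closure hk continuousOn_const Ioo_subset_Icc_self hcl.ge

/-- A continuous function is the primitive of its integrable distributional derivative. -/
theorem sub_eq_integral_of_weakDeriv {T : ℝ} (hT : 0 < T) {f g : ℝ → ℝ}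
    (hf : ContinuousOn f (Icc 0 T)) (hg : IntegrableOn g (Ioo 0 T))
    (h : ∀ φ : 𝓓(timeInterval T, ℝ),
      ∫ t in Ioo 0 T, φ t * g t = -∫ t in Ioo 0 T, deriv φ t * f t)
    {s t : ℝ} (hs : s ∈ Icc 0 T) (ht : t ∈ Icc 0 T) :
    f t - f s = ∫ r in s..t, g r := by
  have hgi : IntervalIntegrable g volume 0 T :=
    (intervalIntegrable_iff_integrableOn_Ioo_of_le hT.le).2 hg
  have hTT : uIcc 0 T = Icc 0 T := uIcc_of_le hT.le
  set G : ℝ → ℝ := fun t => ∫ r in (0 : ℝ)..t, g r with hG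
  have hGac : AbsolutelyContinuousOnInterval G 0 T :=
    hgi.absolutelyContinuousOnInterval_intervalIntegral left_mem_uIcc
  have hGc : ContinuousOn G (Icc 0 T) := by
    rw [← hTT]
    exact hGac.continuousOn
  have hGd : ∀ᵐ x, x ∈ Ioo 0 T → deriv G x = g x := by
    filter_upwards [hgi.ae_hasDerivAt_integral] with x hx hmem
    exact (hx (hTT ▸ Ioo_subset_Icc_self hmem) 0 left_mem_uIcc).deriv
  -- Integrating by parts against the absolutely continuous primitive `G` shows that `f - G` has
  -- zero weak derivative.
  obtain ⟨c, hc⟩ := eq_const_of_integral_deriv_mul_eq_zero hT (k := fun t => f t - G t)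
    (hf.sub hGc) fun φ => by
      have hφ : AbsolutelyContinuousOnInterval φ 0 T :=
        ContDiffOn.absolutelyContinuousOnInterval
          ((φ.contDiff.of_le (by exact_mod_cast le_top)).contDiffOn)
      have h1 := hφ.integral_mul_deriv_eq_deriv_mul hGac
      have hφ0 : ∀ x, x ∉ Ioo 0 T → φ x = 0 := fun x hx =>
        image_eq_zero_of_notMem_tsupport fun h' => hx (φ.tsupport_subset h')
      rw [hφ0 0 (by simp), hφ0 T (by simp), zero_mul, zero_mul, sub_zero, zero_sub,
        intervalIntegral.integral_of_le hT.le, intervalIntegral.integral_of_le hT.le,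
        integral_Ioc_eq_integral_Ioo, integral_Ioc_eq_integral_Ioo] at h1
      have h2 : ∫ x in Ioo 0 T, φ x * deriv G x = ∫ x in Ioo 0 T, φ x * g x := by
        refine setIntegral_congr_ae measurableSet_Ioo ?_
        filter_upwards [hGd] with x hx hmem
        rw [hx hmem]
      have hdc : Continuous (deriv φ) := φ.contDiff.continuous_deriv (by simp)
      have hint : ∀ {k : ℝ → ℝ}, ContinuousOn k (Icc 0 T) →
          IntegrableOn (fun t => deriv φ t * k t) (Ioo 0 T) := fun hk =>
        ((hdc.continuousOn.mul hk).integrableOn_compact isCompact_Icc).mono_set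
          Ioo_subset_Icc_self
      simp only [mul_sub]
      rw [integral_sub (hint hf) (hint hGc)]
      have h3 := h φ
      linarith
  have h1 : f t - G t = c := hc t ht
  have h2 : f s - G s = c := hc s hs
  have hi : ∀ {x}, x ∈ Icc 0 T → IntervalIntegrable g volume 0 x := fun hx =>
    hgi.mono_set (by
      rw [hTT, uIcc_of_le hx.1]
      exact Icc_subset_Icc_right hx.2)
  have h3 : G t - G s = ∫ r in s..t, g r :=
    intervalIntegral.integral_interval_sub_left (hi ht) (hi hs)
  linarith

end DuBoisReymond

/-! ### Duality pairings and time translations -/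

section Pairing

variable {V : Type*} [NormedAddCommGroup V] [NormedSpace ℝ V] {p q : ℝ≥0∞}

theorem aestronglyMeasurable_pairing {α : Type*} [MeasurableSpace α] {μ : Measure α}
    {D : α → StrongDual ℝ V} {w : α → V} (hD : AEStronglyMeasurable D μ)
    (hw : AEStronglyMeasurable w μ) : AEStronglyMeasurable (fun t => D t (w t)) μ :=
  (ContinuousLinearMap.id ℝ (StrongDual ℝ V)).aestronglyMeasurable_comp₂ hD hw

theorem eLpNorm_pairing_le [p.HolderConjugate q] {α : Type*} [MeasurableSpace α] {μ : Measure α}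
    {D : α → StrongDual ℝ V} {w : α → V} (hD : AEStronglyMeasurable D μ)
    (hw : AEStronglyMeasurable w μ) :
    eLpNorm (fun t => D t (w t)) 1 μ ≤ eLpNorm D q μ * eLpNorm w p μ := by
  have : q.HolderConjugate p := ENNReal.HolderConjugate.symm
  simpa using eLpNorm_le_eLpNorm_mul_eLpNorm_of_nnnorm (p := q) (q := p) (r := 1) hD hw
    (fun L x => L x) 1 (Eventually.of_forall fun t => by simpa using (D t).le_opNNNorm (w t))

theorem integrable_pairing [p.HolderConjugate q] {α : Type*} [MeasurableSpace α] {μ : Measure α}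
    {D : α → StrongDual ℝ V} {w : α → V} (hD : MemLp D q μ) (hw : MemLp w p μ) :
    Integrable (fun t => D t (w t)) μ :=
  memLp_one_iff_integrable.1 ⟨aestronglyMeasurable_pairing hD.1 hw.1,
    (eLpNorm_pairing_le (p := p) (q := q) hD.1 hw.1).trans_lt (ENNReal.mul_lt_top hD.2 hw.2)⟩

theorem tendsto_eLpNorm_translate_sub {E : Type*} [NormedAddCommGroup E] (hq : 1 ≤ q)
    (hq' : q ≠ ∞) {f : ℝ → E} (hf : MemLp f q volume) :
    Tendsto (fun σ : ℝ => eLpNorm (fun t => f (t + σ) - f t) q volume) (𝓝 0) (𝓝 0) := by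
  have : Fact (1 ≤ q) := ⟨hq⟩
  have : Fact (q ≠ ∞) := ⟨hq'⟩
  have h1 : Continuous fun σ : ℝ => (DomAddAct.mk σ) +ᵥ hf.toLp f := by
    have h2 : Continuous fun σ : ℝ => DomAddAct.mk σ := DomAddAct.continuous_mk
    exact h2.vadd continuous_const
  have h2 := h1.tendsto 0
  simp only [DomAddAct.mk_vadd_toLp, vadd_eq_add, zero_add] at h2
  rw [Lp.tendsto_Lp_iff_tendsto_eLpNorm''] at h2
  refine h2.congr fun σ => ?_
  congr 1
  funext t
  simp [add_comm]

/-- Only `D` is translated, so Hölder reduces this to the continuity of translations in `L^q`, valid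
as `q < ∞`. -/
theorem tendsto_integral_translate_pairing [p.HolderConjugate q] (hq : 1 ≤ q) (hq' : q ≠ ∞)
    {D : ℝ → StrongDual ℝ V} {w : ℝ → V} (hD : MemLp D q volume) (hw : MemLp w p volume) :
    Tendsto (fun σ : ℝ => ∫ t, D (t + σ) (w t)) (𝓝 0) (𝓝 (∫ t, D t (w t))) := by
  have hDσ : ∀ σ : ℝ, MemLp (fun t => D (t + σ)) q volume := fun σ =>
    hD.comp_measurePreserving (measurePreserving_add_right volume σ)
  refine tendsto_integral_of_L1' _ (integrable_pairing hD hw).1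
    (Eventually.of_forall fun σ => integrable_pairing (hDσ σ) hw) ?_
  have h1 := ENNReal.Tendsto.mul_const (b := eLpNorm w p volume)
    (tendsto_eLpNorm_translate_sub hq hq' hD) (Or.inr hw.2.ne)
  rw [zero_mul] at h1
  refine tendsto_of_tendsto_of_tendsto_of_le_of_le tendsto_const_nhds h1 (fun _ => zero_le)
    fun σ => ?_
  exact eLpNorm_pairing_le (p := p) (q := q) (D := fun t => D (t + σ) - D t)
    ((hDσ σ).1.sub hD.1) hw.1

/-- Fubini turns the increments of the curve, paired with `w t`, into an average over shifts `σ` of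
translated pairings, whose limit as `σ → 0` is known. -/
theorem integral_intervalIntegral_translate_pairing {D : ℝ → StrongDual ℝ V} {w : ℝ → V}
    (hD : Integrable D) (hw : Integrable w) (h : ℝ) :
    Integrable (fun t => ∫ r in t..t + h, D r (w t)) ∧
    ∫ t, ∫ r in t..t + h, D r (w t) = ∫ σ in (0 : ℝ)..h, ∫ t, D (t + σ) (w t) := by
  have h1 : Integrable (fun z : ℝ × ℝ => D z.2 (w z.1)) (volume.prod volume) := by
    refine (hw.norm.mul_prod hD.norm).mono'
      (aestronglyMeasurable_pairing hD.1.comp_snd hw.1.comp_fst)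
      (Eventually.of_forall fun z => ?_)
    rw [mul_comm]
    exact (D z.2).le_opNorm _
  -- The shear `(σ, t) ↦ (t, t + σ)` preserves the measure.
  have h2 : Integrable (Function.uncurry fun σ t : ℝ => D (t + σ) (w t))
      (volume.prod volume) :=
    ((measurePreserving_prod_add_swap (volume : Measure ℝ) volume).integrable_comp h1.1).2 h1
  have h3 : Integrable (Function.uncurry fun σ t : ℝ => D (t + σ) (w t))
      ((volume.restrict (uIoc 0 h)).prod volume) :=
    h2.mono_measure (Measure.prod_mono Measure.restrict_le_self le_rfl)
  have h4 : ∀ t, ∫ r in t..t + h, D r (w t) = ∫ σ in (0 : ℝ)..h, D (t + σ) (w t) := fun t => by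
    rw [intervalIntegral.integral_comp_add_left (fun r => D r (w t)), add_zero]
  simp only [h4]
  refine ⟨?_, (intervalIntegral_integral_swap h3).symm⟩
  have h5 := h3.integral_prod_right
  simp only [intervalIntegral.intervalIntegral_eq_integral_uIoc]
  exact h5.smul (if (0 : ℝ) ≤ h then (1 : ℝ) else -1)

/-- By Hölder's inequality, the product of the `L¹` norms of `D` and `w` on a short interval is
small compared with the length of the interval. -/
theorem eventually_integral_norm_mul_le [p.HolderConjugate q] (hp : 1 ≤ p) (hp' : p ≠ ∞)
    (hq : 1 ≤ q) (hq' : q ≠ ∞)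
    {D : ℝ → StrongDual ℝ V} {w : ℝ → V} (hD : MemLp D q volume) (hw : MemLp w p volume)
    {ε : ℝ} (hε : 0 < ε) :
    ∀ᶠ h in 𝓝[>] (0 : ℝ), ∀ s,
      (∫ t in s..s + h, ‖w t‖) * (∫ t in s..s + h, ‖D t‖) ≤ h * ε := by
  set K := (eLpNorm D q volume).toReal with hK
  have hK0 : 0 ≤ K := ENNReal.toReal_nonneg
  -- Uniform integrability of `w` makes its norm small on every short interval, uniformly in `s`; `K
  -- + 1` rather than `K` avoids a division by zero.
  obtain ⟨δ, hδ, hsmall⟩ := hw.eLpNorm_indicator_le hp hp' (ε := ε / (K + 1)) (by positivity)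
  have hev : ∀ᶠ h in 𝓝[>] (0 : ℝ), h < δ := mem_nhdsWithin_of_mem_nhds (Iio_mem_nhds hδ)
  filter_upwards [hev, self_mem_nhdsWithin] with h hhδ hh0 s
  have hh : (0 : ℝ) < h := hh0
  have hp0 : 0 < p.toReal := ENNReal.toReal_pos (zero_lt_one.trans_le hp).ne' hp'
  have hq0 : 0 < q.toReal := ENNReal.toReal_pos (zero_lt_one.trans_le hq).ne' hq'
  have hpq : 1 / p.toReal + 1 / q.toReal = 1 := by
    have := (ENNReal.HolderConjugate.toReal_of_ne_top hp' hq').inv_add_inv_eq_one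
    simpa using this
  set μ := volume.restrict (Ioc s (s + h)) with hμ
  have hμu : μ univ = ENNReal.ofReal h := by simp [hμ]
  -- Hölder against the constant `1`; the powers of `h` for `p` and for `q` multiply to exactly `h`.
  have key : ∀ {E : Type _} [NormedAddCommGroup E] {f : ℝ → E} {r : ℝ≥0∞}, 1 ≤ r →
      MemLp f r volume → ENNReal.ofReal (∫ t in s..s + h, ‖f t‖) ≤
        eLpNorm f r μ * ENNReal.ofReal h ^ (1 - 1 / r.toReal) := by
    intro E _ f r hr hf
    have h1 := eLpNorm_le_eLpNorm_mul_rpow_measure_univ hr (hf.restrict (Ioc s (s + h))).1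
    rw [hμu, ENNReal.toReal_one, div_one, eLpNorm_one_eq_lintegral_enorm] at h1
    refine le_trans ?_ h1
    rw [intervalIntegral.integral_of_le (by linarith),
      integral_norm_eq_lintegral_enorm (hf.restrict _).1]
    exact ENNReal.ofReal_toReal_le
  have hw1 : eLpNorm w p μ ≤ ENNReal.ofReal (ε / (K + 1)) := by
    rw [hμ, ← eLpNorm_indicator_eq_eLpNorm_restrict measurableSet_Ioc]
    refine hsmall _ measurableSet_Ioc ?_
    rw [Real.volume_Ioc]
    exact ENNReal.ofReal_le_ofReal (by linarith)
  have hD1 : eLpNorm D q μ ≤ ENNReal.ofReal (K + 1) := by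
    refine (eLpNorm_mono_measure D Measure.restrict_le_self).trans ?_
    rw [← ENNReal.ofReal_toReal hD.2.ne]
    exact ENNReal.ofReal_le_ofReal (by linarith)
  have hn1 : 0 ≤ ∫ t in s..s + h, ‖w t‖ :=
    intervalIntegral.integral_nonneg (by linarith) fun _ _ => norm_nonneg _
  rw [← ENNReal.ofReal_le_ofReal_iff (by positivity), ENNReal.ofReal_mul hn1]
  calc ENNReal.ofReal (∫ t in s..s + h, ‖w t‖) * ENNReal.ofReal (∫ t in s..s + h, ‖D t‖)
      ≤ (ENNReal.ofReal (ε / (K + 1)) * ENNReal.ofReal h ^ (1 - 1 / p.toReal)) *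
        (ENNReal.ofReal (K + 1) * ENNReal.ofReal h ^ (1 - 1 / q.toReal)) := by
        gcongr
        · refine (key hp hw).trans ?_
          gcongr
        · refine (key hq hD).trans ?_
          gcongr
    _ = (ENNReal.ofReal (ε / (K + 1)) * ENNReal.ofReal (K + 1)) *
        (ENNReal.ofReal h ^ (1 - 1 / p.toReal) * ENNReal.ofReal h ^ (1 - 1 / q.toReal)) := by ring
    _ = ENNReal.ofReal (h * ε) := by
        rw [← ENNReal.rpow_add _ _ (by simpa using hh) ENNReal.ofReal_ne_top,
          show (1 - 1 / p.toReal) + (1 - 1 / q.toReal) = 1 by linarith, ENNReal.rpow_one,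
          ← ENNReal.ofReal_mul (by positivity), div_mul_cancel₀ _ (by positivity),
          mul_comm h, ENNReal.ofReal_mul hε.le]

end Pairing

/-! ### The chain rule for curves on the whole line -/

section ChainRule

variable {V : Type*} [NormedAddCommGroup V] [NormedSpace ℝ V] {p q : ℝ≥0∞}

theorem intervalIntegrable_of_lowerSemicontinuous_of_bounded {E : ℝ → ℝ}
    (hE : LowerSemicontinuous E) {C : ℝ} (hC : ∀ t, |E t| ≤ C) (a b : ℝ) :
    IntervalIntegrable E volume a b :=
  (intervalIntegrable_const (c := C)).mono_fun hE.measurable.aestronglyMeasurable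
    (Eventually.of_forall fun t => (hC t).trans (le_abs_self C))

/-- Lower semicontinuity bounds right averages of `E` only from below. The bound from above comes
from the subgradient inequality based at `s`: the excess over `E s` is at most `‖w t‖ ∫ ‖D‖`, whose
integral over `(s, s + h)` is at most `h ε` for small `h`. At `s = T` that inequality is not
available to the right, and constancy of `E` is used. -/
theorem eventually_intervalIntegral_le [p.HolderConjugate q] (hp : 1 ≤ p) (hp' : p ≠ ∞)
    (hq : 1 ≤ q) (hq' : q ≠ ∞) {T : ℝ} {D : ℝ → StrongDual ℝ V} {w : ℝ → V} {E : ℝ → ℝ}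
    (hD : MemLp D q volume) (hw : MemLp w p volume) (hDi : Integrable D) (hwi : Integrable w)
    (hE : LowerSemicontinuous E) {C : ℝ} (hC : ∀ t, |E t| ≤ C) (hconst : ∀ t, T ≤ t → E t = E T)
    (hsub : ∀ᵐ t, t ∈ Ioo 0 T → ∀ s, E t - E s ≤ ∫ r in s..t, D r (w t))
    {s : ℝ} (hs : 0 ≤ s) (hsT : s ≤ T) {ε : ℝ} (hε : 0 < ε) :
    ∀ᶠ h in 𝓝[>] (0 : ℝ), ∫ t in s..s + h, E t ≤ h * (E s + ε) := by
  have hEi := intervalIntegrable_of_lowerSemicontinuous_of_bounded hE hC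
  rcases hsT.eq_or_lt with rfl | hlt
  · filter_upwards [self_mem_nhdsWithin] with h hh
    have hh0 : (0 : ℝ) < h := hh
    have h1 : ∫ t in s..s + h, E t = ∫ _ in s..s + h, E s :=
      intervalIntegral.integral_congr fun t ht => by
        rw [uIcc_of_le (by linarith)] at ht
        exact hconst t ht.1
    rw [h1, intervalIntegral.integral_const, smul_eq_mul, add_sub_cancel_left]
    gcongr
    linarith
  · have hev : ∀ᶠ h in 𝓝[>] (0 : ℝ), h < T - s :=
      mem_nhdsWithin_of_mem_nhds (Iio_mem_nhds (by linarith))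
    filter_upwards [hev, self_mem_nhdsWithin,
      eventually_integral_norm_mul_le hp hp' hq hq' hD hw hε] with h hhT hh hHol
    have hh0 : (0 : ℝ) < h := hh
    have hle : s ≤ s + h := by linarith
    have hwn : IntervalIntegrable (fun t => ‖w t‖) volume s (s + h) :=
      hwi.norm.intervalIntegrable
    have h1 : ∫ t in s..s + h, E t ≤
        ∫ t in s..s + h, (E s + ‖w t‖ * ∫ r in s..s + h, ‖D r‖) := by
      rw [intervalIntegral.integral_of_le hle, intervalIntegral.integral_of_le hle]
      refine setIntegral_mono_on_ae (hEi _ _).1 (intervalIntegrable_const.add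
        (hwn.mul_const _)).1 measurableSet_Ioc ?_
      filter_upwards [hsub] with t ht hmem
      have h2 := ht ⟨hs.trans_lt hmem.1, by linarith [hmem.2]⟩ s
      have h3 : ∫ r in s..t, D r (w t) ≤ ‖w t‖ * ∫ r in s..s + h, ‖D r‖ := by
        calc ∫ r in s..t, D r (w t) ≤ ∫ r in s..t, ‖w t‖ * ‖D r‖ := by
              refine intervalIntegral.integral_mono_on hmem.1.le ?_
                (hDi.norm.intervalIntegrable.const_mul _) fun r _ => ?_
              · exact (hDi.apply_continuousLinearMap (w t)).intervalIntegrable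
              · rw [mul_comm]
                exact (le_abs_self _).trans ((D r).le_opNorm _)
          _ = ‖w t‖ * ∫ r in s..t, ‖D r‖ := intervalIntegral.integral_const_mul _ _
          _ ≤ ‖w t‖ * ∫ r in s..s + h, ‖D r‖ := by
              gcongr
              exact intervalIntegral.integral_mono_interval le_rfl hmem.1.le hmem.2
                (Eventually.of_forall fun r => norm_nonneg _) hDi.norm.intervalIntegrable
      linarith
    refine h1.trans ?_
    rw [intervalIntegral.integral_add intervalIntegrable_const (hwn.mul_const _),
      intervalIntegral.integral_const, intervalIntegral.integral_mul_const, smul_eq_mul,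
      add_sub_cancel_left, mul_add]
    exact add_le_add_right (hHol s) _

/-- If `w t` is a subgradient of the energy along the curve with derivative `D`, for almost every
`t`, then the energy `E` grows at least as much as predicted by the chain rule. -/
theorem integral_pairing_le_sub [p.HolderConjugate q] (hp : 1 ≤ p) (hp' : p ≠ ∞)
    (hq : 1 ≤ q) (hq' : q ≠ ∞) {T : ℝ} {D : ℝ → StrongDual ℝ V} {w : ℝ → V} {E : ℝ → ℝ}
    (hD : MemLp D q volume) (hw : MemLp w p volume) (hDi : Integrable D) (hwi : Integrable w)
    (hE : LowerSemicontinuous E) {C : ℝ} (hC : ∀ t, |E t| ≤ C) (hconst : ∀ t, T ≤ t → E t = E T)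
    (hsub : ∀ᵐ t, t ∈ Ioo 0 T → ∀ s, E t - E s ≤ ∫ r in s..t, D r (w t))
    {t₁ t₂ : ℝ} (h₁ : 0 ≤ t₁) (h₁₂ : t₁ ≤ t₂) (h₂ : t₂ ≤ T) :
    ∫ t in t₁..t₂, D t (w t) ≤ E t₂ - E t₁ := by
  have hEi := intervalIntegrable_of_lowerSemicontinuous_of_bounded hE hC
  refine le_of_forall_pos_le_add fun ε hε => ?_
  -- Cutting off `w` alone localizes the pairing to `(t₁, t₂)` and leaves `D` free to be translated.
  set w' : ℝ → V := (Ioo t₁ t₂).indicator w with hw'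
  have hw'p : MemLp w' p volume := hw.indicator measurableSet_Ioo
  have hw'i : Integrable w' := hwi.indicator measurableSet_Ioo
  have hIoo : ∀ (L : ℝ → V → ℝ), (∀ t, L t 0 = 0) →
      ∫ t, L t (w' t) = ∫ t in t₁..t₂, L t (w t) := by
    intro L hL
    rw [intervalIntegral.integral_of_le h₁₂, integral_Ioc_eq_integral_Ioo,
      ← integral_indicator measurableSet_Ioo]
    refine integral_congr_ae (Eventually.of_forall fun t => ?_)
    by_cases ht : t ∈ Ioo t₁ t₂ <;> simp [hw', ht, hL]
  have hΦ := tendsto_integral_translate_pairing (p := p) (q := q) hq hq' hD hw'p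
  have hev1 : ∀ᶠ σ in 𝓝 (0 : ℝ), (∫ t, D t (w' t)) - ε / 3 < ∫ t, D (t + σ) (w' t) :=
    hΦ.eventually_const_lt (by linarith)
  have hev2 : ∀ᶠ σ in 𝓝 (0 : ℝ), E t₁ - ε / 3 < E (t₁ + σ) := by
    have h3 : Tendsto (fun σ => t₁ + σ) (𝓝 0) (𝓝 t₁) := by
      simpa using (continuous_const_add t₁).tendsto 0
    exact h3.eventually (hE t₁ (E t₁ - ε / 3) (by linarith))
  obtain ⟨δ, hδ, hball⟩ := Metric.eventually_nhds_iff.1 (hev1.and hev2)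
  have hev3 : ∀ᶠ h in 𝓝[>] (0 : ℝ), h < δ := mem_nhdsWithin_of_mem_nhds (Iio_mem_nhds hδ)
  have hev4 : ∀ᶠ h in 𝓝[>] (0 : ℝ), h ∈ Ioi (0 : ℝ) := self_mem_nhdsWithin
  obtain ⟨h, hhδ, hh, hup⟩ := (hev3.and (hev4.and
    (eventually_intervalIntegral_le (p := p) (q := q) hp hp' hq hq' hD hw hDi hwi hE hC hconst hsub
      (h₁.trans h₁₂) h₂ (show (0 : ℝ) < ε / 3 by linarith)))).exists
  have hh0 : (0 : ℝ) < h := hh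
  have hin : ∀ σ ∈ Icc 0 h, dist σ 0 < δ := fun σ hσ => by
    rw [Real.dist_eq, sub_zero, abs_of_nonneg hσ.1]
    linarith [hσ.2]
  obtain ⟨hint, hswap⟩ := integral_intervalIntegral_translate_pairing hDi hw'i h
  have hA : h * ((∫ t, D t (w' t)) - ε / 3) ≤ ∫ σ in (0 : ℝ)..h, ∫ t, D (t + σ) (w' t) := by
    have hcont : IntervalIntegrable (fun σ => ∫ t, D (t + σ) (w' t)) volume 0 h := by
      have h4 : Integrable (fun z : ℝ × ℝ => D z.2 (w' z.1)) (volume.prod volume) := by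
        refine (hw'i.norm.mul_prod hDi.norm).mono'
          (aestronglyMeasurable_pairing hDi.1.comp_snd hw'i.1.comp_fst)
          (Eventually.of_forall fun z => ?_)
        rw [mul_comm]
        exact (D z.2).le_opNorm _
      have h5 := ((measurePreserving_prod_add_swap (volume : Measure ℝ)
        volume).integrable_comp h4.1).2 h4
      exact (Integrable.integral_prod_left h5).intervalIntegrable
    have h6 := intervalIntegral.integral_mono_on hh0.le
      (intervalIntegrable_const (c := (∫ t, D t (w' t)) - ε / 3)) hcont
      fun σ hσ => (hball (hin σ hσ)).1.le
    rwa [intervalIntegral.integral_const, smul_eq_mul, sub_zero] at h6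
  have hB : h * (E t₁ - ε / 3) ≤ ∫ t in t₁..t₁ + h, E t := by
    have h6 := intervalIntegral.integral_mono_on (by linarith : t₁ ≤ t₁ + h)
      (intervalIntegrable_const (c := E t₁ - ε / 3)) (hEi t₁ (t₁ + h)) fun t ht => by
        have h7 := (hball (hin (t - t₁) ⟨by linarith [ht.1], by linarith [ht.2]⟩)).2
        rw [add_sub_cancel] at h7
        exact h7.le
    rwa [intervalIntegral.integral_const, smul_eq_mul, add_sub_cancel_left] at h6
  have hEshift : IntervalIntegrable (fun t => E (t + h)) volume t₁ t₂ := by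
    have := (hEi (t₁ + h) (t₂ + h)).comp_add_right h
    simpa using this
  -- The subgradient inequality at `t`, compared with the later time `t + h`.
  have hcmp : ∫ t, ∫ r in t..t + h, D r (w' t) ≤ ∫ t in t₁..t₂, (E (t + h) - E t) := by
    rw [hIoo (fun t x => ∫ r in t..t + h, D r x) (by simp),
      intervalIntegral.integral_of_le h₁₂, intervalIntegral.integral_of_le h₁₂,
      integral_Ioc_eq_integral_Ioo, integral_Ioc_eq_integral_Ioo]
    refine setIntegral_mono_on_ae ?_ ?_ measurableSet_Ioo ?_
    · refine (hint.integrableOn (s := Ioo t₁ t₂)).congr_fun (fun t ht => ?_) measurableSet_Ioo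
      simp [hw', ht]
    · exact ((hEshift.sub (hEi t₁ t₂)).1).mono_set Ioo_subset_Ioc_self
    · filter_upwards [hsub] with t ht hmem
      have h8 := ht ⟨h₁.trans_lt hmem.1, hmem.2.trans_le h₂⟩ (t + h)
      rw [intervalIntegral.integral_symm] at h8
      linarith
  rw [intervalIntegral.integral_sub hEshift (hEi t₁ t₂),
    intervalIntegral.integral_comp_add_right (fun t => E t)] at hcmp
  have hrearr : (∫ t in t₁ + h..t₂ + h, E t) - ∫ t in t₁..t₂, E t =
      (∫ t in t₂..t₂ + h, E t) - ∫ t in t₁..t₁ + h, E t := by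
    have e1 := intervalIntegral.integral_add_adjacent_intervals (hEi t₁ (t₁ + h))
      (hEi (t₁ + h) (t₂ + h))
    have e2 := intervalIntegral.integral_add_adjacent_intervals (hEi t₁ t₂) (hEi t₂ (t₂ + h))
    linarith
  rw [hrearr, hswap] at hcmp
  rw [← hIoo (fun t x => D t x) (by simp)]
  -- The three errors `ε / 3` come from the translations, from lower semicontinuity at `t₁` and from
  -- the average after `t₂`.
  have hfin : h * (∫ t, D t (w' t)) ≤ h * (E t₂ - E t₁ + ε) := by nlinarith
  exact le_of_mul_le_mul_left hfin hh0

/-- The chain rule for an energy of which `w t` is a subgradient along the curve with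
derivative `D`. -/
theorem integral_pairing_eq_sub [p.HolderConjugate q] (hp : 1 ≤ p) (hp' : p ≠ ∞)
    (hq : 1 ≤ q) (hq' : q ≠ ∞) {T : ℝ} {D : ℝ → StrongDual ℝ V} {w : ℝ → V} {E : ℝ → ℝ}
    (hD : MemLp D q volume) (hw : MemLp w p volume) (hDi : Integrable D) (hwi : Integrable w)
    (hE : LowerSemicontinuous E) {C : ℝ} (hC : ∀ t, |E t| ≤ C)
    (hconst₀ : ∀ t, t ≤ 0 → E t = E 0) (hconst : ∀ t, T ≤ t → E t = E T)
    (hsub : ∀ᵐ t, t ∈ Ioo 0 T → ∀ s, E t - E s ≤ ∫ r in s..t, D r (w t))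
    {t₁ t₂ : ℝ} (h₁ : 0 ≤ t₁) (h₁₂ : t₁ ≤ t₂) (h₂ : t₂ ≤ T) :
    ∫ t in t₁..t₂, D t (w t) = E t₂ - E t₁ := by
  refine le_antisymm (integral_pairing_le_sub (p := p) (q := q) hp hp' hq hq' hD hw hDi hwi hE hC
    hconst hsub h₁ h₁₂ h₂) ?_
  have hmp : MeasurePreserving (fun t : ℝ => T - t) volume volume :=
    Measure.measurePreserving_sub_left volume T
  -- Under `t ↦ T - t` the derivative changes sign while the subgradient and the energy do not, so
  -- the hypotheses are preserved.
  have hrev := integral_pairing_le_sub (p := p) (q := q) (T := T) (D := fun t => -D (T - t))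
    (w := fun t => w (T - t)) (E := fun t => E (T - t)) (C := C) hp hp' hq hq'
    (hD.comp_measurePreserving hmp).neg (hw.comp_measurePreserving hmp)
    (hmp.integrable_comp_of_integrable hDi).neg (hmp.integrable_comp_of_integrable hwi)
    (hE.comp (continuous_const.sub continuous_id)) (fun t => hC _)
    (fun t ht => by rw [hconst₀ _ (by linarith), sub_self]) ?_
    (t₁ := T - t₂) (t₂ := T - t₁) (by linarith) (by linarith) (by linarith)
  · simp only [neg_apply, intervalIntegral.integral_neg,
      intervalIntegral.integral_comp_sub_left (fun t => D t (w t)), sub_sub_cancel] at hrev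
    linarith
  · filter_upwards [hmp.quasiMeasurePreserving.ae hsub] with t ht hmem s
    have := ht ⟨by linarith [hmem.2], by linarith [hmem.1]⟩ (T - s)
    refine this.trans_eq ?_
    simp only [neg_apply, intervalIntegral.integral_neg,
      intervalIntegral.integral_comp_sub_left (fun r => D r (w (T - t)))]
    rw [intervalIntegral.integral_symm]

end ChainRule

/-! ### The energy functional on `L²` -/

section Energy

variable {α : Type*} [MeasurableSpace α] {μ : Measure α} {β ζ : ℝ → ℝ}

/-- The energy `∫ B(z)`, with values in `[0, ∞]`. -/
def energyB (μ : Measure α) (β ζ : ℝ → ℝ) (z : α → ℝ) : ℝ≥0∞ := ∫⁻ x, envelopeB β ζ (z x) ∂μ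

theorem aemeasurable_envelopeB_comp (z : Lp ℝ 2 μ) :
    AEMeasurable (fun x => envelopeB β ζ (z x)) μ :=
  measurable_envelopeB.comp_aemeasurable (Lp.aestronglyMeasurable z).aemeasurable

theorem convex_energyB_le (c : ℝ≥0∞) : Convex ℝ {z : Lp ℝ 2 μ | energyB μ β ζ z ≤ c} := by
  intro z hz y hy θ η hθ hη h
  have h1 : ∀ᵐ x ∂μ, envelopeB β ζ ((θ • z + η • y : Lp ℝ 2 μ) x) ≤
      ENNReal.ofReal θ * envelopeB β ζ (z x) + ENNReal.ofReal η * envelopeB β ζ (y x) := by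
    filter_upwards [Lp.coeFn_add (θ • z) (η • y), Lp.coeFn_smul θ z, Lp.coeFn_smul η y]
      with x h1 h2 h3
    rw [h1, Pi.add_apply, h2, h3]
    exact envelopeB_convex hθ hη h
  refine (lintegral_mono_ae h1).trans ?_
  rw [lintegral_add_left' ((aemeasurable_envelopeB_comp z).const_mul _),
    lintegral_const_mul'' _ (aemeasurable_envelopeB_comp z),
    lintegral_const_mul'' _ (aemeasurable_envelopeB_comp y)]
  calc ENNReal.ofReal θ * energyB μ β ζ z + ENNReal.ofReal η * energyB μ β ζ y
      ≤ ENNReal.ofReal θ * c + ENNReal.ofReal η * c := by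
        gcongr
        · exact hz
        · exact hy
    _ = c := by rw [← add_mul, ← ENNReal.ofReal_add hθ hη, h, ENNReal.ofReal_one, one_mul]

/-- Fatou along an almost everywhere convergent subsequence. -/
theorem isClosed_energyB_le (c : ℝ≥0∞) : IsClosed {z : Lp ℝ 2 μ | energyB μ β ζ z ≤ c} := by
  refine IsSeqClosed.isClosed fun z y hz hlim => ?_
  obtain ⟨ns, -, hae⟩ := (tendstoInMeasure_of_tendsto_Lp hlim).exists_seq_tendsto_ae
  calc energyB μ β ζ y ≤ ∫⁻ x, liminf (fun n => envelopeB β ζ (z (ns n) x)) atTop ∂μ := by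
        refine lintegral_mono_ae ?_
        filter_upwards [hae] with x hx
        exact (lowerSemicontinuousAt_iff_le_liminf.1 (lowerSemicontinuous_envelopeB _)).trans
          (liminf_le_liminf_of_le (u := envelopeB β ζ) hx)
    _ ≤ liminf (fun n => energyB μ β ζ (z (ns n))) atTop :=
        lintegral_liminf_le' fun n => aemeasurable_envelopeB_comp _
    _ ≤ c := by
        refine (liminf_le_liminf (Eventually.of_forall fun n => hz (ns n))).trans ?_
        simp

/-- By Mazur's theorem the closed convex sublevel sets are weakly closed. -/
theorem isClosed_energyB_le_of_weakly_continuous {X : Type*} [TopologicalSpace X]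
    {Z : X → Lp ℝ 2 μ} (hZ : Continuous fun t => toWeakSpace ℝ (Lp ℝ 2 μ) (Z t)) (c : ℝ≥0∞) :
    IsClosed {t | energyB μ β ζ (Z t) ≤ c} := by
  have h1 : IsClosed (toWeakSpace ℝ (Lp ℝ 2 μ) '' {z : Lp ℝ 2 μ | energyB μ β ζ z ≤ c}) := by
    have := (convex_energyB_le (μ := μ) (β := β) (ζ := ζ) c).toWeakSpace_closure ℝ
    rw [(isClosed_energyB_le c).closure_eq] at this
    rw [this]
    exact isClosed_closure
  convert h1.preimage hZ using 1
  ext t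
  simp

theorem continuous_integral_mul_of_weakly_continuous {X : Type*} [TopologicalSpace X]
    {s : Set X} {Z : X → Lp ℝ 2 μ}
    (hZ : ContinuousOn (fun t => toWeakSpace ℝ (Lp ℝ 2 μ) (Z t)) s) {γ : α → ℝ}
    (hγ : MemLp γ 2 μ) : ContinuousOn (fun t => ∫ x, Z t x * γ x ∂μ) s := by
  have h1 : Continuous fun z : WeakSpace ℝ (Lp ℝ 2 μ) =>
      innerSL ℝ hγ.toLp ((toWeakSpace ℝ (Lp ℝ 2 μ)).symm z) :=
    WeakBilin.eval_continuous (topDualPairing ℝ (Lp ℝ 2 μ)).flip (innerSL ℝ hγ.toLp)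
  refine (h1.comp_continuousOn hZ).congr fun t _ => ?_
  simp only [Function.comp_apply, LinearEquiv.symm_apply_apply, innerSL_apply_apply, L2.inner_def]
  refine integral_congr_ae ?_
  filter_upwards [hγ.coeFn_toLp] with x hx
  simp [hx]

theorem integrable_toReal_envelopeB {z : Lp ℝ 2 μ} (hz : energyB μ β ζ z ≠ ∞) :
    Integrable (fun x => (envelopeB β ζ (z x)).toReal) μ :=
  integrable_toReal_of_lintegral_ne_top (aemeasurable_envelopeB_comp z) hz

theorem ae_envelopeB_lt_top {z : Lp ℝ 2 μ} (hz : energyB μ β ζ z ≠ ∞) :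
    ∀ᵐ x ∂μ, envelopeB β ζ (z x) < ∞ :=
  ae_lt_top' (aemeasurable_envelopeB_comp z) hz

theorem integral_toReal_envelopeB {z : Lp ℝ 2 μ} (hz : energyB μ β ζ z ≠ ∞) :
    ∫ x, (envelopeB β ζ (z x)).toReal ∂μ = (energyB μ β ζ z).toReal :=
  integral_toReal (aemeasurable_envelopeB_comp z) (ae_envelopeB_lt_top hz)

/-- Finite energy confines `z` almost everywhere to the closure of the range of `β`, the only place
where `functionB` and the envelope are known to agree. -/
theorem lintegral_functionB_eq_energyB (hβ : Monotone β) (hc : Continuous β) (h0 : β 0 = 0)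
    (hζ : Monotone ζ) (hζ0 : ζ 0 = 0) {M₀ M₁ : ℝ} (hM₀ : 0 < M₀)
    (hζc : ∀ s : ℝ, M₀ * |s| - M₁ ≤ |ζ s|) {z : Lp ℝ 2 μ} (hz : energyB μ β ζ z ≠ ∞) :
    ∫⁻ x, functionB β ζ (z x) ∂μ = energyB μ β ζ z := by
  refine lintegral_congr_ae ?_
  filter_upwards [ae_envelopeB_lt_top hz] with x hx
  refine (envelopeB_eq_functionB hβ hc h0 hζ hζ0 ?_).symm
  by_contra h
  exact hx.ne (envelopeB_eq_top hβ hc h0 hζ hζ0 hM₀ hζc h)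

end Energy

/-! ### The chain rule on a bounded interval -/

section ChainRuleInterval

variable {V : Type*} [NormedAddCommGroup V] [NormedSpace ℝ V] {p q : ℝ≥0∞}

theorem memLp_indicator_of_restrict {α E : Type*} [MeasurableSpace α] {μ : Measure α}
    [NormedAddCommGroup E] {f : α → E} {s : Set α} (hs : MeasurableSet s)
    (hf : MemLp f p (μ.restrict s)) : MemLp (s.indicator f) p μ :=
  (memLp_indicator_iff_restrict hs).2 hf

theorem integrable_indicator_of_memLp_restrict {α E : Type*} [MeasurableSpace α] {μ : Measure α}
    [NormedAddCommGroup E] {f : α → E} {s : Set α} [IsFiniteMeasure (μ.restrict s)]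
    (hs : MeasurableSet s) (hp : 1 ≤ p) (hf : MemLp f p (μ.restrict s)) :
    Integrable (s.indicator f) μ :=
  (integrable_indicator_iff hs).2 (hf.integrable hp)

theorem integrableOn_apply (hq : 1 ≤ q) {T : ℝ} {D : ℝ → StrongDual ℝ V}
    (hD : MemLp D q (volume.restrict (Ioo 0 T))) (x : V) :
    IntegrableOn (fun r => D r x) (Ioo 0 T) :=
  Integrable.apply_continuousLinearMap (hD.integrable hq) x

/-- The chain rule on `[0,T]` for a lower semicontinuous energy of which `w t` is a subgradient
along the curve with derivative `D`. -/
theorem integral_pairing_eq_sub_of_subgradient [p.HolderConjugate q] (hp : 1 ≤ p) (hp' : p ≠ ∞)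
    (hq : 1 ≤ q) (hq' : q ≠ ∞) {T : ℝ} (hT : 0 < T) {D : ℝ → StrongDual ℝ V} {w : ℝ → V}
    {E : ℝ → ℝ} (hD : MemLp D q (volume.restrict (Ioo 0 T)))
    (hw : MemLp w p (volume.restrict (Ioo 0 T))) (hE : LowerSemicontinuous E) {C : ℝ}
    (hC : ∀ t, |E t| ≤ C) (hproj : ∀ t, E (projIcc 0 T hT.le t) = E t)
    (hsub : ∀ᵐ t ∂(volume.restrict (Ioo 0 T)), ∀ s ∈ Icc 0 T, ∀ ℓ : StrongDual ℝ V,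
      (∀ x, ℓ x = ∫ r in s..t, D r x) → E t - E s ≤ ℓ (w t)) :
    ∀ t₁ ∈ Icc 0 T, ∀ t₂ ∈ Icc 0 T, ∫ t in t₁..t₂, D t (w t) = E t₂ - E t₁ := by
  obtain ⟨π, hπ⟩ : ∃ π : ℝ → ℝ, ∀ t, π t = projIcc 0 T hT.le t := ⟨_, fun _ => rfl⟩
  have hπmem : ∀ t, π t ∈ Icc 0 T := fun t => hπ t ▸ (projIcc 0 T hT.le t).2
  have hπid : ∀ {t}, t ∈ Icc 0 T → π t = t := fun ht => by simp [hπ, projIcc_of_mem hT.le ht]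
  have hπ0 : ∀ t, t ≤ 0 → π t = 0 := fun t ht => by simp [hπ, projIcc_of_le_left hT.le ht]
  have hπT : ∀ t, T ≤ t → π t = T := fun t ht => by simp [hπ, projIcc_of_right_le hT.le ht]
  -- Extending `D` and `w` by zero matches the extension of `E` by its endpoint values.
  obtain ⟨D', hD'⟩ : ∃ D' : ℝ → StrongDual ℝ V, D' = (Ioo 0 T).indicator D := ⟨_, rfl⟩
  obtain ⟨w', hw'⟩ : ∃ w' : ℝ → V, w' = (Ioo 0 T).indicator w := ⟨_, rfl⟩
  have hD'q : MemLp D' q volume := by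
    rw [hD']
    exact memLp_indicator_of_restrict measurableSet_Ioo hD
  have hw'p : MemLp w' p volume := by
    rw [hw']
    exact memLp_indicator_of_restrict measurableSet_Ioo hw
  have hD'i : Integrable D' := by
    rw [hD']
    exact integrable_indicator_of_memLp_restrict measurableSet_Ioo hq hD
  have hw'i : Integrable w' := by
    rw [hw']
    exact integrable_indicator_of_memLp_restrict measurableSet_Ioo hp hw
  have hIoo : ∀ {s t : ℝ}, s ∈ Icc 0 T → t ∈ Icc 0 T → ∀ {f g : ℝ → ℝ},
      (∀ r ∈ Ioo 0 T, f r = g r) → ∫ r in s..t, f r = ∫ r in s..t, g r := by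
    intro s t hs ht f g hfg
    refine intervalIntegral.integral_congr_ae ?_
    -- The interval of integration is closed on the right, so the endpoint `T` must be discarded.
    have h1 : ∀ᵐ r : ℝ, r ≠ T := by simp [ae_iff]
    filter_upwards [h1] with r hr hmem
    refine hfg r ⟨(le_min hs.1 ht.1).trans_lt hmem.1, lt_of_le_of_ne ?_ hr⟩
    exact hmem.2.trans (max_le hs.2 ht.2)
  have hout : ∀ s (x : V), ∫ r in s..π s, D' r x = 0 := by
    intro s x
    refine intervalIntegral.integral_zero_ae (Eventually.of_forall fun r hr => ?_)
    have hr' : r ∉ Ioo 0 T := by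
      rintro ⟨hr0, hrT⟩
      rcases le_total s 0 with h | h
      · rw [hπ0 s h, uIoc_of_le h] at hr
        exact absurd hr.2 (not_le.2 hr0)
      rcases le_total T s with h' | h'
      · rw [hπT s h', uIoc_of_ge h'] at hr
        exact absurd hr.1 (not_lt.2 hrT.le)
      · rw [hπid ⟨h, h'⟩] at hr
        simp [uIoc] at hr
    simp [hD', hr']
  have hsub' : ∀ᵐ t, t ∈ Ioo 0 T → ∀ s, E t - E s ≤ ∫ r in s..t, D' r (w' t) := by
    rw [← ae_restrict_iff' measurableSet_Ioo]
    filter_upwards [hsub, ae_restrict_mem measurableSet_Ioo] with t ht hmem s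
    have htI := Ioo_subset_Icc_self hmem
    have hD'x : ∀ x a b, IntervalIntegrable (fun r => D' r x) volume a b := fun x a b =>
      (hD'i.apply_continuousLinearMap x).intervalIntegrable
    have hw't : w' t = w t := by simp [hw', hmem]
    -- The Bochner integral of `D'` provides the functional `ℓ` required by `hsub`.
    have happ : ∀ x, (∫ r in s..t, D' r) x = ∫ r in s..t, D' r x :=
      ContinuousLinearMap.intervalIntegral_apply hD'i.intervalIntegrable
    rw [hw't, ← happ, ← hproj s, ← hπ]
    refine ht _ (hπmem s) _ fun x => ?_
    rw [happ, ← intervalIntegral.integral_add_adjacent_intervals (b := π s) (hD'x x _ _)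
      (hD'x x _ _), hout s, zero_add]
    exact hIoo (hπmem s) htI fun r hr => by simp [hD', hr]
  have hle : ∀ t₁ ∈ Icc 0 T, ∀ t₂ ∈ Icc 0 T, t₁ ≤ t₂ → ∫ t in t₁..t₂, D t (w t) = E t₂ - E t₁ := by
    intro t₁ h₁ t₂ h₂ h₁₂
    rw [← integral_pairing_eq_sub (p := p) (q := q) hp hp' hq hq' hD'q hw'p hD'i hw'i hE hC
      (fun t ht => by rw [← hproj t, ← hπ, hπ0 t ht]) (fun t ht => by rw [← hproj t, ← hπ, hπT t ht])
      hsub' h₁.1 h₁₂ h₂.2]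
    exact hIoo h₁ h₂ fun r hr => by simp [hD', hw', hr]
  intro t₁ h₁ t₂ h₂
  rcases le_total t₁ t₂ with h | h
  · exact hle t₁ h₁ t₂ h₂ h
  · rw [intervalIntegral.integral_symm, hle t₂ h₂ t₁ h₁ h, neg_sub]

end ChainRuleInterval

/-! ### The energy along a weakly continuous curve -/

section EnergyInTime

variable {α : Type*} [MeasurableSpace α] {μ : Measure α} {β ζ : ℝ → ℝ} {T : ℝ}
  {Z : ℝ → Lp ℝ 2 μ}

/-- A bound on the energy of a weakly continuous curve at almost every time holds at every time. -/
theorem energyB_le_of_ae_le (hT : 0 < T)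
    (hZ : ContinuousOn (fun t => toWeakSpace ℝ (Lp ℝ 2 μ) (Z t)) (Icc 0 T)) {C : ℝ≥0∞}
    (hae : ∀ᵐ t ∂(volume.restrict (Ioo 0 T)), energyB μ β ζ (Z t) ≤ C) :
    ∀ t ∈ Icc 0 T, energyB μ β ζ (Z t) ≤ C := by
  have hcl := isClosed_energyB_le_of_weakly_continuous (β := β) (ζ := ζ)
    (Z := fun t : Icc (0 : ℝ) T => Z t)
    (continuousOn_iff_continuous_domRestrict.1 hZ) C
  have hcl' : IsClosed {t | energyB μ β ζ (Z (projIcc 0 T hT.le t)) ≤ C} :=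
    hcl.preimage continuous_projIcc
  have hproj : ∀ {t}, t ∈ Icc 0 T → (projIcc 0 T hT.le t : ℝ) = t := fun ht => by
    rw [projIcc_of_mem hT.le ht]
  have hIoo : Ioo 0 T ⊆ {t | energyB μ β ζ (Z (projIcc 0 T hT.le t)) ≤ C} := by
    rw [← sdiff_eq_empty]
    -- The exceptional times form a null open set, hence none; closedness then adds the endpoints.
    refine (isOpen_Ioo.sdiff hcl').eq_empty_of_measure_zero (μ := volume) ?_
    rw [ae_restrict_iff' measurableSet_Ioo, ae_iff] at hae
    refine measure_mono_null ?_ hae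
    rintro t ⟨hmem, ht⟩ h
    refine ht ?_
    have h1 := h hmem
    rw [← hproj (Ioo_subset_Icc_self hmem)] at h1
    exact h1
  intro t ht
  have h1 := hcl'.closure_subset_iff.2 hIoo
  rw [closure_Ioo hT.ne] at h1
  have h2 : energyB μ β ζ (Z (projIcc 0 T hT.le t)) ≤ C := h1 ht
  rwa [hproj ht] at h2

theorem lowerSemicontinuous_toReal_energyB (hT : 0 ≤ T)
    (hZ : ContinuousOn (fun t => toWeakSpace ℝ (Lp ℝ 2 μ) (Z t)) (Icc 0 T))
    (hne : ∀ t ∈ Icc 0 T, energyB μ β ζ (Z t) ≠ ∞) :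
    LowerSemicontinuous fun t => (energyB μ β ζ (Z (projIcc 0 T hT t))).toReal := by
  refine lowerSemicontinuous_iff_isClosed_preimage.2 fun y => ?_
  rcases lt_or_ge y 0 with hy | hy
  · convert isClosed_empty
    refine eq_empty_of_forall_notMem fun t ht => ?_
    have h1 : (energyB μ β ζ (Z (projIcc 0 T hT t))).toReal ≤ y := ht
    have h2 : 0 ≤ (energyB μ β ζ (Z (projIcc 0 T hT t))).toReal := ENNReal.toReal_nonneg
    linarith
  · have hcl := isClosed_energyB_le_of_weakly_continuous (β := β) (ζ := ζ)
      (Z := fun t : Icc (0 : ℝ) T => Z t)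
      (continuousOn_iff_continuous_domRestrict.1 hZ) (ENNReal.ofReal y)
    convert hcl.preimage (continuous_projIcc (h := hT)) using 1
    ext t
    exact (ENNReal.le_ofReal_iff_toReal_le (hne _ (projIcc 0 T hT t).2) hy).symm

end EnergyInTime

/-! ### Time increments and the subgradient inequality in `W^{1,p}_0` -/

section Main

variable {d : ℕ} {Ω : Opens (EuclideanSpace ℝ (Fin d))} {p : ℝ≥0∞} [Fact (1 ≤ p)]

/-- The increments of the weakly continuous representative are the integrals of the distributional
time derivative. -/
theorem integral_sub_mul_eq_of_isTimeDeriv {T : ℝ} (hT : 0 < T)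
    {u : EuclideanSpace ℝ (Fin d) × ℝ → ℝ}
    {Z : ℝ → Lp ℝ 2 (volume.restrict (Ω : Set (EuclideanSpace ℝ (Fin d))))}
    (hZ_cont : ContinuousOn (fun t => toWeakSpace ℝ _ (Z t)) (Icc 0 T))
    (hZ : ∀ᵐ t ∂(volume.restrict (Ioo 0 T)),
      Z t =ᵐ[volume.restrict (Ω : Set (EuclideanSpace ℝ (Fin d)))] fun x => u (x, t))
    {D : ℝ → StrongDual ℝ (W0 Ω p)} (hDi : ∀ x, IntegrableOn (fun r => D r x) (Ioo 0 T))
    (hD : IsTimeDeriv Ω T p u D) (γ : 𝓓(Ω, ℝ)) {s t : ℝ} (hs : s ∈ Icc 0 T) (ht : t ∈ Icc 0 T) :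
    ∫ x in (Ω : Set (EuclideanSpace ℝ (Fin d))), (Z t x - Z s x) * γ x =
      ∫ r in s..t, D r (testW0 Ω p γ) := by
  have hγ := testFunction_memLp Ω 2 γ
  have hmul : ∀ z : Lp ℝ 2 (volume.restrict (Ω : Set (EuclideanSpace ℝ (Fin d)))),
      Integrable (fun x => z x * γ x) (volume.restrict (Ω : Set (EuclideanSpace ℝ (Fin d)))) :=
    fun z => (Lp.memLp z).integrable_mul hγ
  rw [← sub_eq_integral_of_weakDeriv hT
    (f := fun t => ∫ x in (Ω : Set (EuclideanSpace ℝ (Fin d))), Z t x * γ x)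
    (continuous_integral_mul_of_weakly_continuous hZ_cont hγ)
    (hDi (testW0 Ω p γ)) ?_ hs ht]
  · rw [← integral_sub (hmul _) (hmul _)]
    simp only [sub_mul]
  · intro φ
    rw [hD φ γ]
    congr 1
    refine integral_congr_ae ?_
    filter_upwards [hZ] with t ht
    rw [← integral_const_mul]
    refine integral_congr_ae ?_
    filter_upwards [ht] with x hx
    rw [hx]
    ring

/-- The subgradient inequality for the energy: its increment is dominated by the pairing of the
increment of the argument with the subgradient. -/
theorem energyB_sub_le {β ζ : ℝ → ℝ} (hβ : Monotone β) (hc : Continuous β) (h0 : β 0 = 0)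
    (hζ : Monotone ζ) (hζ0 : ζ 0 = 0) (hp : p ≠ ∞)
    [IsFiniteMeasure (volume.restrict (Ω : Set (EuclideanSpace ℝ (Fin d))))]
    {z y : Lp ℝ 2 (volume.restrict (Ω : Set (EuclideanSpace ℝ (Fin d))))}
    (hz : energyB (volume.restrict (Ω : Set (EuclideanSpace ℝ (Fin d)))) β ζ z ≠ ∞)
    (hy : energyB (volume.restrict (Ω : Set (EuclideanSpace ℝ (Fin d)))) β ζ y ≠ ∞)
    {v : EuclideanSpace ℝ (Fin d) → ℝ} {w : W0 Ω p}
    (hw : w.1.1 =ᵐ[volume.restrict (Ω : Set (EuclideanSpace ℝ (Fin d)))] fun x => ζ (v x))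
    (hzv : z =ᵐ[volume.restrict (Ω : Set (EuclideanSpace ℝ (Fin d)))] fun x => β (v x))
    {ℓ : StrongDual ℝ (W0 Ω p)}
    (hℓ : ∀ γ : 𝓓(Ω, ℝ), ℓ (testW0 Ω p γ) =
      ∫ x in (Ω : Set (EuclideanSpace ℝ (Fin d))), (z x - y x) * γ x) :
    (energyB (volume.restrict (Ω : Set (EuclideanSpace ℝ (Fin d)))) β ζ z).toReal -
      (energyB (volume.restrict (Ω : Set (EuclideanSpace ℝ (Fin d)))) β ζ y).toReal ≤ ℓ w := by
  rw [← integral_toReal_envelopeB hz, ← integral_toReal_envelopeB hy,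
    ← integral_sub (integrable_toReal_envelopeB hz) (integrable_toReal_envelopeB hy)]
  -- Here `f = z - y`, integrable because `Ω` has finite measure, and the minorant is the difference
  -- of the energy densities.
  refine integral_le_of_le_mul hp
    (((Lp.memLp z).sub (Lp.memLp y)).integrable one_le_two)
    ((integrable_toReal_envelopeB hz).sub (integrable_toReal_envelopeB hy)) hℓ w ?_
  filter_upwards [hw, hzv, ae_envelopeB_lt_top hy] with x hwx hzx hyx
  -- The affine minorant at `a = v x` touches `B` at `z x = β (v x)` and has slope `ζ (v x)`, the
  -- value of `w`.
  have h1 := affine_le_toReal_envelopeB (v x) hyx.ne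
  have h2 : (envelopeB β ζ (z x)).toReal = primitiveB β ζ (β (v x)) := by
    rw [hzx, envelopeB_apply hβ hc h0 hζ,
      ENNReal.toReal_ofReal (primitiveB_nonneg hβ hc h0 hζ hζ0 _)]
  rw [Pi.sub_apply, Pi.sub_apply, h2, hwx, hzx]
  linarith

end Main

end DegenerateParabolic

end

/-! ### The chain rule for `B(β(v))` -/

open DegenerateParabolic in
theorem lemma3p5 {d : ℕ} (hd : 0 < d)
    (Ω : Opens (EuclideanSpace ℝ (Fin d)))
    (hΩ : Bornology.IsBounded (Ω : Set (EuclideanSpace ℝ (Fin d))))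
    (T : ℝ) (hT : 0 < T)
    -- conjugate exponents `p, p' ∈ (1, ∞)`
    (p p' : ℝ≥0∞) [Fact (1 ≤ p)] (hp1 : 1 < p) (hp : p < ∞) (hpp' : p.HolderConjugate p')
    (ζ β : ℝ → ℝ) (Lζ Lβ : ℝ≥0) (M₀ M₁ : ℝ)
    (hLζ : 0 < Lζ) (hζ_mono : Monotone ζ) (hζ_lip : LipschitzWith Lζ ζ) (hζ_zero : ζ 0 = 0)
    (hM₀ : 0 < M₀) (hM₁ : 0 < M₁) (hζ_coercive : ∀ s : ℝ, M₀ * |s| - M₁ ≤ |ζ s|)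
    (hLβ : 0 < Lβ) (hβ_mono : Monotone β) (hβ_lip : LipschitzWith Lβ β) (hβ_zero : β 0 = 0)
    -- `v` is measurable on `Ω × (0,T)`
    (v : EuclideanSpace ℝ (Fin d) × ℝ → ℝ)
    (hv : AEMeasurable v
      (volume.restrict ((Ω : Set (EuclideanSpace ℝ (Fin d))) ×ˢ Ioo (0 : ℝ) T)))
    -- `ζ(v) ∈ L^p(0,T; W^{1,p}_0(Ω))`, with `w t` the element `ζ(v(·,t))` of `W^{1,p}_0(Ω)`
    (w : ℝ → DegenerateParabolic.W0 Ω p)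
    (hw_mem : MemLp w p (volume.restrict (Ioo 0 T)))
    (hw : ∀ᵐ t ∂(volume.restrict (Ioo 0 T)),
      (w t).1.1 =ᵐ[volume.restrict (Ω : Set (EuclideanSpace ℝ (Fin d)))] fun x => ζ (v (x, t)))
    -- `B(β(v)) ∈ L^∞(0,T; L^1(Ω))`
    (hB : essSup (fun t : ℝ => ∫⁻ x in (Ω : Set (EuclideanSpace ℝ (Fin d))),
      DegenerateParabolic.functionB β ζ (β (v (x, t)))) (volume.restrict (Ioo 0 T)) < ∞)
    -- `β(v) ∈ C([0,T]; L^2(Ω)-w)`, with `Z` the weakly continuous representative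
    (Z : ℝ → Lp ℝ 2 (volume.restrict (Ω : Set (EuclideanSpace ℝ (Fin d)))))
    (hZ_cont : ContinuousOn (fun t => toWeakSpace ℝ _ (Z t)) (Icc 0 T))
    (hZ : ∀ᵐ t ∂(volume.restrict (Ioo 0 T)),
      Z t =ᵐ[volume.restrict (Ω : Set (EuclideanSpace ℝ (Fin d)))] fun x => β (v (x, t)))
    -- `∂_t β(v) = D ∈ L^{p'}(0,T; W^{-1,p'}(Ω))`
    (D : ℝ → StrongDual ℝ (DegenerateParabolic.W0 Ω p))
    (hD_mem : MemLp D p' (volume.restrict (Ioo 0 T)))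
    (hD : DegenerateParabolic.IsTimeDeriv Ω T p (fun z => β (v z)) D) :
    (∀ t ∈ Icc 0 T, ∫⁻ x in (Ω : Set (EuclideanSpace ℝ (Fin d))),
        DegenerateParabolic.functionB β ζ (Z t x) < ∞) ∧
    ContinuousOn (fun t => (∫⁻ x in (Ω : Set (EuclideanSpace ℝ (Fin d))),
        DegenerateParabolic.functionB β ζ (Z t x)).toReal) (Icc 0 T) ∧
    IntegrableOn (fun t => D t (w t)) (Ioo 0 T) ∧
    ∀ t₁ ∈ Icc 0 T, ∀ t₂ ∈ Icc 0 T,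
      ∫ t in t₁..t₂, D t (w t) =
        (∫⁻ x in (Ω : Set (EuclideanSpace ℝ (Fin d))),
          DegenerateParabolic.functionB β ζ (Z t₂ x)).toReal -
        (∫⁻ x in (Ω : Set (EuclideanSpace ℝ (Fin d))),
          DegenerateParabolic.functionB β ζ (Z t₁ x)).toReal := by
  have hpne : p ≠ ∞ := hp.ne
  have hcon : p'.HolderConjugate p := ENNReal.HolderConjugate.symm
  have hq : 1 ≤ p' := ENNReal.HolderConjugate.one_le p' p
  have hq' : p' ≠ ∞ := ((ENNReal.HolderConjugate.lt_top_iff_one_lt p' p).2 hp1).ne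
  have hβc : Continuous β := hβ_lip.continuous
  have hfin : IsFiniteMeasure (volume.restrict (Ω : Set (EuclideanSpace ℝ (Fin d)))) := ⟨by
    rw [Measure.restrict_apply_univ]
    exact hΩ.measure_lt_top⟩
  obtain ⟨C, hC, hbound⟩ : ∃ C : ℝ≥0∞, C < ∞ ∧ ∀ t ∈ Icc 0 T,
      energyB (volume.restrict (Ω : Set (EuclideanSpace ℝ (Fin d)))) β ζ (Z t) ≤ C := by
    refine ⟨_, hB, energyB_le_of_ae_le hT hZ_cont ?_⟩
    filter_upwards [hZ, ENNReal.ae_le_essSup (μ := volume.restrict (Ioo 0 T))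
      (fun t : ℝ => ∫⁻ x in (Ω : Set (EuclideanSpace ℝ (Fin d))),
        functionB β ζ (β (v (x, t))))] with t ht hle
    refine le_trans (le_of_eq (lintegral_congr_ae ?_)) hle
    filter_upwards [ht] with x hx
    rw [hx]
    exact envelopeB_eq_functionB hβ_mono hβc hβ_zero hζ_mono hζ_zero (subset_closure ⟨_, rfl⟩)
  have hne : ∀ t ∈ Icc 0 T,
      energyB (volume.restrict (Ω : Set (EuclideanSpace ℝ (Fin d)))) β ζ (Z t) ≠ ∞ :=
    fun t ht => ((hbound t ht).trans_lt hC).ne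
  have hval : ∀ t ∈ Icc 0 T, ∫⁻ x in (Ω : Set (EuclideanSpace ℝ (Fin d))),
      functionB β ζ (Z t x) =
        energyB (volume.restrict (Ω : Set (EuclideanSpace ℝ (Fin d)))) β ζ (Z t) := fun t ht =>
    lintegral_functionB_eq_energyB hβ_mono hβc hβ_zero hζ_mono hζ_zero hM₀ hζ_coercive (hne t ht)
  obtain ⟨E, hE⟩ : ∃ E : ℝ → ℝ, E = fun t =>
      (energyB (volume.restrict (Ω : Set (EuclideanSpace ℝ (Fin d)))) β ζ
        (Z (projIcc 0 T hT.le t))).toReal := ⟨_, rfl⟩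
  have hEt : ∀ t ∈ Icc 0 T, E t =
      (energyB (volume.restrict (Ω : Set (EuclideanSpace ℝ (Fin d)))) β ζ (Z t)).toReal :=
    fun t ht => by rw [hE]; simp only [projIcc_of_mem hT.le ht]
  have hElsc : LowerSemicontinuous E := by
    rw [hE]
    exact lowerSemicontinuous_toReal_energyB hT.le hZ_cont hne
  have hEC : ∀ t, |E t| ≤ C.toReal := fun t => by
    rw [hE, abs_of_nonneg ENNReal.toReal_nonneg]
    exact ENNReal.toReal_mono hC.ne (hbound _ (projIcc 0 T hT.le t).2)
  have hsub : ∀ᵐ t ∂(volume.restrict (Ioo 0 T)), ∀ s ∈ Icc 0 T, ∀ ℓ : StrongDual ℝ (W0 Ω p),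
      (∀ x, ℓ x = ∫ r in s..t, D r x) → E t - E s ≤ ℓ (w t) := by
    filter_upwards [hw, hZ, ae_restrict_mem measurableSet_Ioo] with t hwt hZt hmem s hs ℓ hℓ
    have htI := Ioo_subset_Icc_self hmem
    rw [hEt t htI, hEt s hs]
    refine energyB_sub_le hβ_mono hβc hβ_zero hζ_mono hζ_zero hpne (hne t htI) (hne s hs) hwt
      hZt fun γ => ?_
    rw [hℓ]
    exact (integral_sub_mul_eq_of_isTimeDeriv hT hZ_cont hZ (integrableOn_apply (V := W0 Ω p) hq hD_mem) hD γ
      hs htI).symm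
  have hall := integral_pairing_eq_sub_of_subgradient (V := W0 Ω p) (p := p) (q := p') Fact.out hpne hq hq' hT
    hD_mem hw_mem hElsc hEC (fun t => by simp only [hE, projIcc_val]) hsub
  have hreal : ∀ t ∈ Icc 0 T, (∫⁻ x in (Ω : Set (EuclideanSpace ℝ (Fin d))),
      functionB β ζ (Z t x)).toReal = E t := fun t ht => by rw [hval t ht, hEt t ht]
  have hint : IntegrableOn (fun t => D t (w t)) (Ioo 0 T) :=
    integrable_pairing (V := W0 Ω p) (p := p) (q := p') hD_mem hw_mem
  refine ⟨fun t ht => ?_, ?_, hint, fun t₁ h₁ t₂ h₂ => ?_⟩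
  · rw [hval t ht]
    exact (hne t ht).lt_top
  -- By the identity based at time `0`, the energy is `E 0` plus a continuous primitive.
  · have h0 : (0 : ℝ) ∈ Icc 0 T := ⟨le_rfl, hT.le⟩
    have h1 : ContinuousOn (fun t => ∫ r in (0 : ℝ)..t, D r (w r)) (Icc 0 T) := by
      have h2 : IntegrableOn (fun t => D t (w t)) (uIcc 0 T) := by
        rw [uIcc_of_le hT.le, integrableOn_Icc_iff_integrableOn_Ioo]
        exact hint
      have h3 := intervalIntegral.continuousOn_primitive_interval h2
      rwa [uIcc_of_le hT.le] at h3
    refine (h1.add (continuousOn_const (c := E 0))).congr fun t ht => ?_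
    rw [hreal t ht, Pi.add_apply, hall 0 h0 t ht]
    ring
  · rw [hreal t₁ h₁, hreal t₂ h₂, hall t₁ h₁ t₂ h₂]
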